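/- Let $N\ge 3$, $\Delta>0$, $\sigma_u>0$, $\Sigma_0>0$. On a probability space let $\tilde v\sim\mathcal N(0,\Sigma_0)$ and $\Delta u_1,\dots,\Delta u_N\sim \mathcal N(0,\sigma_u^2\Delta)$ be mutually independent. **Kyle's equilibrium.** Let $\hat\lambda_n,\hat\beta_n$ ($1\le n\le N$) and $\hat\Sigma_n,\hat\alpha_n$ ($0\le n\le N$) be the coefficients of Kyle's equilibrium, i.e. the solution of $\Sigma_0$ given, $\alpha_N=0$, $$\lambda_n=\frac{\beta_n\Sigma_{n-1}}{\beta_n^2\Sigma_{n-1}\Delta+\sigma_u^2},\quad \Sigma_n=\frac{\Sigma_{n-1}\sigma_u^2}{\beta_n^2\Sigma_{n-1}\Delta+\sigma_u^2},\quad \alpha_{n-1}=\frac1{4\lambda_n(1-\alpha_n\lambda_n)},\quad \beta_n=\frac{1-2\alpha_n\lambda_n}{2\Delta\lambda_n(1-\alpha_n\lambda_n)}\qquad(1\le n\le N)$$ with $\lambda_n>0$ and $\lambda_n\alpha_n<1$ for $1\le n\le N$. For $\vec\lambda,\vec\beta\in\mathbb R^N$ let $x(\vec\lambda,\vec\beta)=(x_0,\dots,x_N)$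 be the stock holdings given by $x_0=p_0=0$ and $$x_n-x_{n-1}=\beta_n(\tilde v-p_{n-1})\Delta,\qquad p_n-p_{n-1}=\lambda_n(\Delta u_n+x_n-x_{n-1}),\qquad 1\le n\le N.$$ The equilibrium holdings are $\hat x:=x(\vec{\hat\lambda},\vec{\hat\beta})$. **Policy iteration.** For $\vec\beta\in\mathbb R^N$ define $\lambda_n(\vec\beta)$ and $\Sigma_n(\vec\beta)$ by the forward recursion $$\Sigma_0(\vec\beta)=\Sigma_0,\quad \lambda_n(\vec\beta)=\frac{\beta_n\Sigma_{n-1}(\vec\beta)}{\beta_n^2\Sigma_{n-1}(\vec\beta)\Delta+\sigma_u^2},\quad \Sigma_n(\vec\beta)=\frac{\Sigma_{n-1}(\vec\beta)\sigma_u^2}{\beta_n^2\Sigma_{n-1}(\vec\beta)\Delta+\sigma_u^2},$$ and then, backwards with $\alpha_N=0$ and $\lambda_n=\lambda_n(\vec\beta)$, $$T(\vec\beta)_n=\frac{1-2\alpha_n\lambda_n}{2\Delta\lambda_n(1-\alpha_n\lambda_n)},\qquad \alpha_{n-1}=\frac{1}{4\lambda_n(1-\alpha_n\lambda_n)},\qquad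 n=N,\dots,1.$$ Let $\mathrm{dom}(T)\subset\mathbb R^N$ be the set of $\vec\beta$ for which $\lambda_n\ne0$ and $\alpha_n\lambda_n\neq1$ for all $n$. A vector $\vec\beta$ is identified with the stock holdings $x(\vec\beta):=x(\vec\lambda(\vec\beta),\vec\beta)$. **Consistent extensions and stability.** Let $\mathcal L^2$ be the set of stock holdings $x=(x_0,\dots,x_N)$ (tuples of random variables) with $\|x\|:=\big(\sum_{n=1}^N\mathbb E[(x_n-x_{n-1})^2]\big)^{1/2}<\infty$. A consistent extension of $T$ is a map $T^\circ:\mathrm{dom}(T^\circ)\to\mathcal L^2$ with $\{x(\vec\beta):\vec\beta\in\mathrm{dom}(T)\}\subseteq\mathrm{dom}(T^\circ)\subseteq\mathcal L^2$ and $T^\circ(x(\vec\beta))=x(T(\vec\beta))$ for all $\vec\beta\in\mathrm{dom}(T)$; one sets $T^\circ(x):=(\infty,\dots,\infty)$ for $x\notin\mathrm{dom}(T^\circ)$. Kyle's equilibrium is locally stable with respect to the generalized policy iterations of $T^\circ$ if there is $\epsilon>0$ such that, for every $x^{(0)}\in\mathrm{dom}(T^\circ)$ with $0<\|x^{(0)}-\hat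 x\|<\epsilon$, the sequence $x^{(m+1)}:=T^\circ(x^{(m)})$ satisfies $\lim_{m\to\infty}\|x^{(m)}-\hat x\|=0$ (where the distance of $(\infty,\dots,\infty)$ to $\hat x$ is $\infty$). **Claim.** For every consistent extension $T^\circ$ of $T$, Kyle's equilibrium is not locally stable with respect to the generalized policy iterations of $T^\circ$. -/

import Mathlib

open MeasureTheory ProbabilityTheory Filter Topology
open scoped ENNReal

namespace Kyle

/- Conventions.  There are `N` trading times.  Quantities indexed by `1, …, N` are functions on
`Fin N`, where `n : Fin N` stands for the trading time `n + 1`.  Quantities indexed by `0, …, N` are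
functions on `Fin (N + 1)`.  So for the trading time represented by `n : Fin N`, the index `n.succ`
is that time and the index `n.castSucc` is the previous time.  `Δ` is the time step, `σ ^ 2 * Δ` is
the variance of each noise-trader order, and `S₀` is the variance of the liquidating value. -/

/-- The conditional variances `S_0, …, S_N` generated by the trading intensities `β`:
`S_n = S_{n-1} σ² / (β_n² S_{n-1} Δ + σ²)`. -/
noncomputable def condVar (Δ σ S₀ : ℝ) {N : ℕ} (β : Fin N → ℝ) : Fin (N + 1) → ℝ :=
  Fin.induction (motive := fun _ => ℝ) S₀
    (fun n s => s * σ ^ 2 / (β n ^ 2 * s * Δ + σ ^ 2))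

/-- The pricing coefficients (Kyle's lambda) generated by the trading intensities `β`:
`lam_n = β_n S_{n-1} / (β_n² S_{n-1} Δ + σ²)`. -/
noncomputable def kyleLambda (Δ σ S₀ : ℝ) {N : ℕ} (β : Fin N → ℝ) (n : Fin N) : ℝ :=
  β n * condVar Δ σ S₀ β n.castSucc / (β n ^ 2 * condVar Δ σ S₀ β n.castSucc * Δ + σ ^ 2)

/-- The value function coefficients `α_0, …, α_N` of the insider facing the pricing coefficients
`lam`: `α_N = 0` and `α_{n-1} = 1 / (4 lam_n (1 - α_n lam_n))`. -/
noncomputable def valueCoeff {N : ℕ} (lam : Fin N → ℝ) : Fin (N + 1) → ℝ :=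
  Fin.reverseInduction (motive := fun _ => ℝ) 0
    (fun n a => 1 / (4 * lam n * (1 - a * lam n)))

/-- The insider's optimal trading intensities when she faces the pricing coefficients `lam`:
`β_n = (1 - 2 α_n lam_n) / (2 Δ lam_n (1 - α_n lam_n))`. -/
noncomputable def bestResponse (Δ : ℝ) {N : ℕ} (lam : Fin N → ℝ) (n : Fin N) : ℝ :=
  (1 - 2 * valueCoeff lam n.succ * lam n) /
    (2 * Δ * lam n * (1 - valueCoeff lam n.succ * lam n))

/-- The policy iteration operator `T` on vectors of trading intensities (on its domain `domT`). -/
noncomputable def T (Δ σ S₀ : ℝ) {N : ℕ} (β : Fin N → ℝ) : Fin N → ℝ :=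
  bestResponse Δ (kyleLambda Δ σ S₀ β)

/-- The domain of `T`: no denominator occurring in the computation of `T β` vanishes.  (The
denominators in `condVar` and `kyleLambda` are positive for positive parameters.) -/
def domT (Δ σ S₀ : ℝ) (N : ℕ) : Set (Fin N → ℝ) :=
  {β | ∀ n : Fin N, kyleLambda Δ σ S₀ β n ≠ 0 ∧
    1 - valueCoeff (kyleLambda Δ σ S₀ β) n.succ * kyleLambda Δ σ S₀ β n ≠ 0}

/-- `(lam, S, α, β)` are the coefficients of Kyle's (linear) equilibrium: they solve Kyle's system
with `S_0 = S₀`, `α_N = 0`, the pricing coefficients are positive, and the insider's second-order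
condition holds. -/
structure IsEquilibrium (Δ σ S₀ : ℝ) {N : ℕ} (lam : Fin N → ℝ) (S α : Fin (N + 1) → ℝ)
    (β : Fin N → ℝ) : Prop where
  S_zero : S 0 = S₀
  α_last : α (Fin.last N) = 0
  lam_eq : ∀ n : Fin N,
    lam n = β n * S n.castSucc / (β n ^ 2 * S n.castSucc * Δ + σ ^ 2)
  S_eq : ∀ n : Fin N,
    S n.succ = S n.castSucc * σ ^ 2 / (β n ^ 2 * S n.castSucc * Δ + σ ^ 2)
  α_eq : ∀ n : Fin N, α n.castSucc = 1 / (4 * lam n * (1 - α n.succ * lam n))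
  β_eq : ∀ n : Fin N,
    β n = (1 - 2 * α n.succ * lam n) / (2 * Δ * lam n * (1 - α n.succ * lam n))
  lam_pos : ∀ n : Fin N, 0 < lam n
  second_order : ∀ n : Fin N, lam n * α n.succ < 1

/-- Stock holdings `(x_0, …, x_N)`, as functions on the sample space. -/
abbrev Holdings (Ω : Type*) (N : ℕ) : Type _ := Fin (N + 1) → Ω → ℝ

/-- The stock order `x_n - x_{n-1}`. -/
def order {Ω : Type*} {N : ℕ} (x : Holdings Ω N) (n : Fin N) : Ω → ℝ :=
  x n.succ - x n.castSucc

/-- The norm `‖x‖ = (∑_{n=1}^N E[(x_n - x_{n-1})²])^{1/2}`, with values in `[0, ∞]`. -/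
noncomputable def policyNorm {Ω : Type*} [MeasurableSpace Ω] (P : Measure Ω) {N : ℕ}
    (x : Holdings Ω N) : ℝ≥0∞ :=
  (∑ n : Fin N, ∫⁻ ω, ENNReal.ofReal (order x n ω ^ 2) ∂P) ^ (1 / 2 : ℝ)

/-- The set `ℒ²` of stock holdings with square-integrable orders. -/
def L2Holdings {Ω : Type*} [MeasurableSpace Ω] (P : Measure Ω) (N : ℕ) : Set (Holdings Ω N) :=
  {x | (∀ n : Fin N, AEMeasurable (order x n) P) ∧ policyNorm P x < ⊤}

section

variable {Ω : Type*} (Δ : ℝ) {N : ℕ} (v : Ω → ℝ) (u : Fin N → Ω → ℝ)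

/-- The prices `p_0 = 0`, `p_n = p_{n-1} + lam_n (u_n + β_n (v - p_{n-1}) Δ)` that result from the
pricing coefficients `lam` and the insider's orders `β_n (v - p_{n-1}) Δ`, where `u_n` is the
noise-trader order. -/
def price (lam β : Fin N → ℝ) : Fin (N + 1) → Ω → ℝ :=
  Fin.induction (motive := fun _ => Ω → ℝ) 0
    (fun n p ω => p ω + lam n * (u n ω + β n * (v ω - p ω) * Δ))

/-- The insider's holdings, `x_0 = 0` and `x_n = x_{n-1} + β_n (v - p_{n-1}) Δ`, for the
pricing coefficients `lam` and the trading intensities `β`. -/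
def holdings (lam β : Fin N → ℝ) : Holdings Ω N :=
  Fin.induction (motive := fun _ => Ω → ℝ) 0
    (fun n x ω => x ω + β n * (v ω - price Δ v u lam β n.castSucc ω) * Δ)

/-- The stock holdings that the vector `β` of trading intensities stands for: the insider trades
`β_n (v - p_{n-1}) Δ` at the prices with the coefficients `kyleLambda` generated by `β`. -/
noncomputable def policy (σ S₀ : ℝ) (β : Fin N → ℝ) : Holdings Ω N :=
  holdings Δ v u (kyleLambda Δ σ S₀ β) β

end

/-- A consistent extension `T°` of `T` to stock holdings in `ℒ²`: its domain lies between the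
policies given by `domT` and `ℒ²`, and it agrees with `T` on the former.  The values of `toFun`
outside `dom` are irrelevant. -/
structure ConsistentExtension {Ω : Type*} [MeasurableSpace Ω] (P : Measure Ω) {N : ℕ}
    (v : Ω → ℝ) (u : Fin N → Ω → ℝ) (Δ σ S₀ : ℝ) where
  dom : Set (Holdings Ω N)
  toFun : Holdings Ω N → Holdings Ω N
  dom_subset : dom ⊆ L2Holdings P N
  mapsTo : ∀ x ∈ dom, toFun x ∈ L2Holdings P N
  policy_mem : ∀ β ∈ domT Δ σ S₀ N, policy Δ v u σ S₀ β ∈ dom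
  consistent : ∀ β ∈ domT Δ σ S₀ N,
    toFun (policy Δ v u σ S₀ β) = policy Δ v u σ S₀ (T Δ σ S₀ β)

section

variable {Ω : Type*} [MeasurableSpace Ω] {P : Measure Ω} {N : ℕ} {v : Ω → ℝ} {u : Fin N → Ω → ℝ}
  {Δ σ S₀ : ℝ}

open Classical in
/-- One step of the generalized policy iteration.  Here `none` stands for `(∞, …, ∞)`, the value
outside the domain, which itself is not in the domain. -/
noncomputable def ConsistentExtension.step (E : ConsistentExtension P v u Δ σ S₀) :
    Option (Holdings Ω N) → Option (Holdings Ω N)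
  | none => none
  | some x => if x ∈ E.dom then some (E.toFun x) else none

/-- The distance `‖x - xhat‖`, which is infinite for `x = (∞, …, ∞)`. -/
noncomputable def distTo (P : Measure Ω) (xhat : Holdings Ω N) : Option (Holdings Ω N) → ℝ≥0∞
  | none => ⊤
  | some x => policyNorm P (x - xhat)

/-- The equilibrium holdings `xhat` are locally stable with respect to the generalized policy
iterations `x^{(m+1)} = T° (x^{(m)})`. -/
def ConsistentExtension.LocallyStable (E : ConsistentExtension P v u Δ σ S₀)
    (xhat : Holdings Ω N) : Prop :=
  ∃ ε : ℝ, 0 < ε ∧ ∀ x ∈ E.dom,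
    0 < policyNorm P (x - xhat) → policyNorm P (x - xhat) < ENNReal.ofReal ε →
      Tendsto (fun m : ℕ => distTo P xhat (E.step^[m] (some x))) atTop (𝓝 0)

end

end Kyle

/-! Norm convergence of policies forces convergence of the intensities
(`tendsto_of_tendsto_policyNorm_sub`), and a consistent extension has no freedom along a `T`-orbit
that stays in `domT` (`iterate_step`). So it suffices to find, in every neighbourhood of the
equilibrium intensities, a vector whose `T`-orbit stays in `domT` and does not converge to them.
This is a volume argument.

At the equilibrium, `α_N = 0` puts the last intensity at a critical point of the last pricing
coefficient, so the derivative of `T` ignores the last coordinate. On the other `N - 1` coordinates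
it multiplies volume by more than `1` (`exists_hasStrictFDerivAt`). Indeed, it is a forward scan
(intensities to pricing coefficients) followed by a backward scan (pricing coefficients to best
response), both triangular, corrected by a rank-one term from the last period. The signs make the
correction enlarge the determinant (`one_lt_abs_det_of_scan`). The diagonal product depends only on
the numbers `q_n = α_n lam_n`: its last factor is at least `0.699` and every earlier one at least
`1.5`. As `N ≥ 3`, there is at least one earlier factor, and `1.5 * 0.699 > 1` (`one_lt_abs_prod`).

Because of this expansion, the points whose orbits remain near the equilibrium form a null set
(`exists_nhds_measure_orbits_eq_zero`). The points outside `domT`, or with singular derivative, are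
also null (`ae_mem_domT`), and so are all iterated preimages of both sets. A neighbourhood has
positive measure, so it contains a point avoiding all of them (`exists_orbit_not_tendsto`). -/

namespace Kyle

/-! ### Transversal volume expansion and null sets -/

section Expansion

open scoped NNReal

/-- A map whose strict derivative at `x₀` factors through a projection `π`, and which expands the
volume transversally, has a neighbourhood of `x₀` such that any set that is a graph over its
projection and whose forward orbits stay in the neighbourhood has a null projection. -/
theorem exists_nhds_measure_image_eq_zero {E F : Type*} [NormedAddCommGroup E] [NormedSpace ℝ E]
    [NormedAddCommGroup F] [NormedSpace ℝ F] [FiniteDimensional ℝ F] [MeasurableSpace F]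
    [BorelSpace F] (μ : Measure F) [μ.IsAddHaarMeasure] {T : E → E} {x₀ : E} (π : E →L[ℝ] F)
    (K : F →L[ℝ] E) (hT : HasStrictFDerivAt T (K.comp π) x₀) (hdet : 1 < |(π.comp K).det|) :
    ∃ U ∈ 𝓝 x₀, ∀ A : Set E, (∀ x ∈ A, ∀ k, T^[k] x ∈ U) →
      (∀ a ∈ A, ∀ b ∈ A, ‖a - b‖ ≤ ‖π a - π b‖) → μ (π '' A) = 0 := by
  obtain ⟨m, hm1, hm⟩ : ∃ m : ℝ≥0, 1 < m ∧ (m : ℝ≥0∞) < ENNReal.ofReal |(π.comp K).det| := by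
    obtain ⟨m, h1, h2⟩ := ENNReal.lt_iff_exists_nnreal_btwn.1 (ENNReal.one_lt_ofReal.2 hdet)
    exact ⟨m, by exact_mod_cast h1, h2⟩
  -- Any map that is `δ`-close to the linear map `π ∘ K` on a set multiplies its measure by at least
  -- `m`.
  obtain ⟨δ, hδ, hδ0⟩ := ((mul_le_addHaar_image_of_lt_det μ _ hm).and self_mem_nhdsWithin).exists
  have hδ0 : 0 < δ := hδ0
  have hdet0 : (π.comp K).det ≠ 0 := by
    intro h; rw [h] at hdet; norm_num at hdet
  obtain ⟨c, hc0, hc⟩ : ∃ c : ℝ, 0 < c ∧ ∀ y, c * ‖y‖ ≤ ‖π (K y)‖ := by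
    let e := (π.comp K).toContinuousLinearEquivOfDetNeZero hdet0
    have he : ∀ y, e y = π (K y) := fun y => rfl
    refine ⟨(‖(e.symm : F →L[ℝ] F)‖ + 1)⁻¹, by positivity, fun y => ?_⟩
    rw [inv_mul_le_iff₀ (by positivity), ← he]
    calc ‖y‖ = ‖(e.symm : F →L[ℝ] F) (e y)‖ := by simp
      _ ≤ ‖(e.symm : F →L[ℝ] F)‖ * ‖e y‖ := ContinuousLinearMap.le_opNorm _ _
      _ ≤ _ := by gcongr; linarith
  -- `κ` is a graph constant that `T` preserves: differences of images have norm at most `‖K‖ + 1`,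
  -- and their projections at least `c / 2`, times the old projected difference.
  set κ : ℝ := max 1 ((‖K‖ + 1) / (c / 2)) with hκ
  have hκ1 : 1 ≤ κ := le_max_left _ _
  have hκ2 : ‖K‖ + 1 ≤ κ * (c / 2) := by
    rw [← div_le_iff₀ (by positivity)]; exact le_max_right _ _
  set p : ℝ := ‖π‖ + 1
  have hp : 0 < p := by positivity
  -- The three bounds keep the nonlinear error, measured on `κ`-graphs, below `1` for the upper
  -- estimate, below `c / 2` for the lower one, and below `δ` for the volume estimate.
  set η : ℝ := min (min (1 / κ) (c / 2 / (p * κ))) (δ / (p * κ)) with hη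
  have hη0 : 0 < η := by
    have : (0 : ℝ) < δ := hδ0
    refine lt_min (lt_min ?_ ?_) ?_ <;> positivity
  have hη1 : η * κ ≤ 1 := by
    rw [← le_div_iff₀ (by positivity)]; exact (min_le_left _ _).trans (min_le_left _ _)
  have hη2 : p * (η * κ) ≤ c / 2 := by
    have : η ≤ c / 2 / (p * κ) := (min_le_left _ _).trans (min_le_right _ _)
    rw [le_div_iff₀ (by positivity)] at this; linarith
  have hη3 : p * (η * κ) ≤ δ := by
    have : η ≤ δ / (p * κ) := min_le_right _ _
    rw [le_div_iff₀ (by positivity)] at this; linarith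
  obtain ⟨s, hs, hsT⟩ := hT.approximates_deriv_on_nhds (c := ⟨η, hη0.le⟩)
    (Or.inr (by exact_mod_cast hη0))
  have hsT' : ∀ x ∈ s, ∀ y ∈ s, ‖T x - T y - K (π x - π y)‖ ≤ η * ‖x - y‖ := by
    intro x hx y hy
    have := hsT x hx y hy
    rw [ContinuousLinearMap.comp_apply, map_sub] at this
    exact this
  refine ⟨s ∩ Metric.ball x₀ 1, inter_mem hs (Metric.ball_mem_nhds _ one_pos), ?_⟩
  have hfin : μ (π '' (s ∩ Metric.ball x₀ 1)) < ⊤ :=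
    ((π.lipschitz.isBounded_image (Metric.isBounded_ball.subset
      (Set.inter_subset_right)))).measure_lt_top
  -- The induction runs over all `κ`-graphs, since `T '' A` is again one, though not a `1`-graph in
  -- general.
  have key : ∀ k : ℕ, ∀ A : Set E, (∀ x ∈ A, ∀ k, T^[k] x ∈ s ∩ Metric.ball x₀ 1) →
      (∀ a ∈ A, ∀ b ∈ A, ‖a - b‖ ≤ κ * ‖π a - π b‖) →
      (m : ℝ≥0∞) ^ k * μ (π '' A) ≤ μ (π '' (s ∩ Metric.ball x₀ 1)) := by
    intro k
    induction k with
    | zero =>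
      intro A hA _
      simp only [pow_zero, one_mul]
      exact measure_mono (Set.image_mono fun x hx => hA x hx 0)
    | succ k ih =>
      intro A hA hcone
      have hest : ∀ a ∈ A, ∀ b ∈ A,
          ‖T a - T b - K (π a - π b)‖ ≤ η * κ * ‖π a - π b‖ := by
        intro a ha b hb
        refine (hsT' a (hA a ha 0).1 b (hA b hb 0).1).trans ?_
        rw [mul_assoc]
        gcongr
        exact hcone a ha b hb
      have hest2 : ∀ a ∈ A, ∀ b ∈ A,
          ‖π (T a) - π (T b) - π (K (π a - π b))‖ ≤ p * (η * κ) * ‖π a - π b‖ := by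
        intro a ha b hb
        rw [← map_sub, ← map_sub]
        refine (π.le_opNorm _).trans ?_
        rw [mul_assoc]
        have := hest a ha b hb
        gcongr
        simp [p]
      have hinj : Set.InjOn π A := by
        intro a ha b hb h
        have := hcone a ha b hb
        rw [h, sub_self, norm_zero, mul_zero] at this
        exact sub_eq_zero.1 (norm_le_zero_iff.1 this)
      have h1 : m * μ (π '' A) ≤ μ (π '' (T '' A)) := by
        rcases A.eq_empty_or_nonempty with rfl | hne
        · simp
        have : Nonempty E := ⟨x₀⟩
        -- `g` lifts the projection back to `A`, so one step of `T` becomes a map `π ∘ T ∘ g` on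
        -- `F`, `δ`-close to `π ∘ K`.
        let g := Function.invFunOn π A
        have hg : ∀ a ∈ A, g (π a) = a := hinj.leftInvOn_invFunOn
        have himg : (fun y => π (T (g y))) '' (π '' A) = π '' (T '' A) := by
          rw [Set.image_image, Set.image_image]
          exact Set.image_congr fun a ha => by rw [hg a ha]
        rw [← himg]
        apply hδ
        rintro _ ⟨a, ha, rfl⟩ _ ⟨b, hb, rfl⟩
        simp only [hg a ha, hg b hb]
        refine (hest2 a ha b hb).trans ?_
        gcongr
      have h2 : (m : ℝ≥0∞) ^ k * μ (π '' (T '' A)) ≤ μ (π '' (s ∩ Metric.ball x₀ 1)) := by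
        apply ih
        · rintro _ ⟨a, ha, rfl⟩ j
          exact hA a ha (j + 1)
        · rintro _ ⟨a, ha, rfl⟩ _ ⟨b, hb, rfl⟩
          have e1 : ‖T a - T b‖ ≤ (‖K‖ + 1) * ‖π a - π b‖ := by
            have h3 := hest a ha b hb
            have h4 := K.le_opNorm (π a - π b)
            have h5 : ‖T a - T b‖ ≤ ‖T a - T b - K (π a - π b)‖ + ‖K (π a - π b)‖ := by
              simpa using norm_add_le (T a - T b - K (π a - π b)) (K (π a - π b))
            have h6 : η * κ * ‖π a - π b‖ ≤ 1 * ‖π a - π b‖ := by gcongr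
            linarith
          have e2 : c / 2 * ‖π a - π b‖ ≤ ‖π (T a) - π (T b)‖ := by
            have h3 := hest2 a ha b hb
            have h4 := hc (π a - π b)
            have h5 : ‖π (K (π a - π b))‖ ≤ ‖π (T a) - π (T b)‖ +
                ‖π (T a) - π (T b) - π (K (π a - π b))‖ := by
              simpa using norm_sub_le (π (T a) - π (T b)) (π (T a) - π (T b) - π (K (π a - π b)))
            have h6 : p * (η * κ) * ‖π a - π b‖ ≤ c / 2 * ‖π a - π b‖ := by gcongr
            linarith
          calc ‖T a - T b‖ ≤ (‖K‖ + 1) * ‖π a - π b‖ := e1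
            _ ≤ κ * (c / 2) * ‖π a - π b‖ := by gcongr
            _ = κ * (c / 2 * ‖π a - π b‖) := by ring
            _ ≤ _ := by gcongr
      calc (m : ℝ≥0∞) ^ (k + 1) * μ (π '' A) = m ^ k * (m * μ (π '' A)) := by ring
        _ ≤ m ^ k * μ (π '' (T '' A)) := by gcongr
        _ ≤ _ := h2
  intro A hA hcone
  by_contra hne
  have hle : ∀ k : ℕ, (m : ℝ≥0∞) ^ k ≤ μ (π '' (s ∩ Metric.ball x₀ 1)) / μ (π '' A) := by
    intro k
    have := key k A hA fun a ha b hb => (hcone a ha b hb).trans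
      (le_mul_of_one_le_left (norm_nonneg _) hκ1)
    have hA' : μ (π '' A) ≠ ⊤ := by
      refine ((measure_mono (Set.image_mono fun x hx => ?_)).trans_lt hfin).ne
      exact hA x hx 0
    exact (ENNReal.le_div_iff_mul_le (Or.inl hne) (Or.inl hA')).2 this
  have htop := ENNReal.tendsto_pow_atTop_nhds_top_iff.2 (show (1 : ℝ≥0∞) < m by exact_mod_cast hm1)
  have := le_of_tendsto' htop hle
  exact absurd (top_le_iff.1 this) (ENNReal.div_lt_top hfin.ne hne).ne

/-- Preimages of null sets are null near points where the derivative is invertible. -/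
theorem measure_preimage_inter_eq_zero {E : Type*} [NormedAddCommGroup E] [NormedSpace ℝ E]
    [FiniteDimensional ℝ E] [MeasurableSpace E] [BorelSpace E] (μ : Measure E)
    [μ.IsAddHaarMeasure] {T : E → E} {G W : Set E}
    (hG : ∀ x ∈ G, ∃ T' : E →L[ℝ] E, HasStrictFDerivAt T T' x ∧ T'.det ≠ 0) (hW : μ W = 0) :
    μ (T ⁻¹' W ∩ G) = 0 := by
  refine measure_null_of_locally_null _ fun x hx => ?_
  obtain ⟨T', hT', hdet⟩ := hG x hx.2
  obtain ⟨m, hm0, hm⟩ : ∃ m : ℝ≥0, 0 < m ∧ (m : ℝ≥0∞) < ENNReal.ofReal |T'.det| := by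
    obtain ⟨m, h1, h2⟩ := ENNReal.lt_iff_exists_nnreal_btwn.1
      (ENNReal.ofReal_pos.2 (abs_pos.2 hdet))
    exact ⟨m, by exact_mod_cast h1, h2⟩
  obtain ⟨δ, hδ, hδ0⟩ := ((mul_le_addHaar_image_of_lt_det μ _ hm).and self_mem_nhdsWithin).exists
  obtain ⟨s, hs, hsT⟩ := hT'.approximates_deriv_on_nhds (c := δ) (Or.inr hδ0)
  refine ⟨T ⁻¹' W ∩ G ∩ s, inter_mem self_mem_nhdsWithin (mem_nhdsWithin_of_mem_nhds hs), ?_⟩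
  have h1 := hδ (T ⁻¹' W ∩ G ∩ s) T (hsT.mono_set Set.inter_subset_right)
  have h2 : μ (T '' (T ⁻¹' W ∩ G ∩ s)) = 0 :=
    measure_mono_null (by rintro _ ⟨y, hy, rfl⟩; exact hy.1.1) hW
  rw [h2] at h1
  have h3 := le_antisymm h1 zero_le
  rcases mul_eq_zero.1 h3 with h | h
  · exact absurd (by exact_mod_cast h) hm0.ne'
  · exact h

/-- The zero set of a function that is meromorphic along all lines through a point at which it is
continuous and nonzero is a null set. -/
theorem measure_zeros_eq_zero_of_meromorphic {E : Type*} [NormedAddCommGroup E] [NormedSpace ℝ E]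
    [FiniteDimensional ℝ E] [MeasurableSpace E] [BorelSpace E] (μ : Measure E)
    [μ.IsAddHaarMeasure] {f : E → ℝ} (hf : Measurable f) (x₀ : E)
    (hmer : ∀ d : E, Meromorphic fun t : ℝ => f (x₀ + t • d)) (hcont : ContinuousAt f x₀)
    (hne : f x₀ ≠ 0) : μ {x | f x = 0} = 0 := by
  have hline : ∀ d : E, volume {t : ℝ | f (x₀ + t • d) = 0} = 0 := by
    intro d
    set g : ℝ → ℝ := fun t => f (x₀ + t • d)
    have hg0 : ∀ᶠ t in 𝓝[≠] (0 : ℝ), g t ≠ 0 := by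
      apply nhdsWithin_le_nhds
      have hc : ContinuousAt g 0 := by
        apply ContinuousAt.comp (g := f)
        · simpa using hcont
        · fun_prop
      exact hc.eventually_ne (by simpa [g] using hne)
    -- Finite order at one point of the line propagates to all of them, so the zeros are isolated.
    have hord : ∀ t, meromorphicOrderAt g t ≠ ⊤ :=
      (hmer d).exists_meromorphicOrderAt_ne_top_iff_forall.1
        ⟨0, (meromorphicOrderAt_ne_top_iff_eventually_ne_zero (hmer d 0)).2 hg0⟩
    refine measure_null_of_locally_null _ fun t _ => ?_
    have ht := (meromorphicOrderAt_ne_top_iff_eventually_ne_zero (hmer d t)).1 (hord t)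
    rw [eventually_nhdsWithin_iff] at ht
    refine ⟨{t}, ?_, by simp⟩
    rw [mem_nhdsWithin_iff_eventually]
    filter_upwards [ht] with s hs h0
    by_contra hst
    exact hs hst h0
  have hmeas : MeasurableSet {p : ℝ × E | f (x₀ + p.1 • p.2) = 0} := by
    have : Measurable fun p : ℝ × E => f (x₀ + p.1 • p.2) := hf.comp (by fun_prop)
    exact this (measurableSet_singleton 0)
  have hprod : (volume.prod μ) {p : ℝ × E | f (x₀ + p.1 • p.2) = 0} = 0 := by
    rw [Measure.prod_apply_symm hmeas]
    simp only [lintegral_eq_zero_iff (measurable_measure_prodMk_right hmeas)]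
    exact Filter.Eventually.of_forall fun d => hline d
  have hae := (Measure.measure_prod_null hmeas).1 hprod
  have hne0 : ∀ᵐ t : ℝ, t ≠ 0 := by
    simp [ae_iff]
  -- By Fubini in (time, direction), the zeros seen at a fixed time `t ≠ 0` are null among
  -- directions. They are a dilated and translated copy of the zero set.
  obtain ⟨t, ht, ht0⟩ := (hae.and hne0).exists
  have h1 : (Prod.mk t ⁻¹' {p : ℝ × E | f (x₀ + p.1 • p.2) = 0}) =
      (fun y => t • y) ⁻¹' ((fun y => x₀ + y) ⁻¹' {x | f x = 0}) := rfl
  simp only [h1, Pi.zero_apply] at ht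
  rw [Measure.addHaar_preimage_smul μ ht0, measure_preimage_add] at ht
  rcases mul_eq_zero.1 ht with h | h
  · simp [ht0] at h
  · exact h

end Expansion

/-! ### Orbits that do not converge -/

section Orbits

/-- The projection of `ℝ^(M+1)` that forgets the last coordinate. -/
noncomputable def initL (M : ℕ) : (Fin (M + 1) → ℝ) →L[ℝ] (Fin M → ℝ) :=
  ContinuousLinearMap.pi fun i => ContinuousLinearMap.proj i.castSucc

@[simp] theorem initL_apply {M : ℕ} (x : Fin (M + 1) → ℝ) (i : Fin M) :
    initL M x i = x i.castSucc := rfl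

/-- The points whose orbits stay near a given point form a null set if the map is transversally
volume expanding there. -/
theorem exists_nhds_measure_orbits_eq_zero {M : ℕ} {T : (Fin (M + 1) → ℝ) → (Fin (M + 1) → ℝ)}
    (hTm : Measurable T) {x₀ : Fin (M + 1) → ℝ} (K : (Fin M → ℝ) →L[ℝ] (Fin (M + 1) → ℝ))
    (hT : HasStrictFDerivAt T (K.comp (initL M)) x₀) (hdet : 1 < |((initL M).comp K).det|) :
    ∃ U ∈ 𝓝 x₀, volume {x | ∀ k, T^[k] x ∈ U} = 0 := by
  obtain ⟨U, hU, h⟩ := exists_nhds_measure_image_eq_zero volume (initL M) K hT hdet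
  obtain ⟨O, hOU, hO, hxO⟩ := mem_nhds_iff.1 hU
  refine ⟨O, hO.mem_nhds hxO, ?_⟩
  set W : Set (Fin (M + 1) → ℝ) := {x | ∀ k, T^[k] x ∈ O} with hW
  have hWm : MeasurableSet W := by
    have : W = ⋂ k, T^[k] ⁻¹' O := by ext; simp [hW]
    rw [this]
    exact MeasurableSet.iInter fun k => (hTm.iterate k) hO.measurableSet
  have hmp := volume_preserving_piFinSuccAbove (fun _ : Fin (M + 1) => ℝ) (Fin.last M)
  have hmp' := hmp.symm
  rw [← hmp'.measure_preimage hWm.nullMeasurableSet]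
  change (volume.prod volume) _ = 0
  rw [Measure.measure_prod_null ((MeasurableEquiv.measurable _) hWm)]
  -- Fubini in the last coordinate: on a slice where it is constant, differences and their
  -- projections have the same sup norm, so the slice is a `1`-graph.
  refine Filter.Eventually.of_forall fun c => ?_
  have := h {x ∈ W | x (Fin.last M) = c} (fun x hx k => hOU (hx.1 k)) (by
    rintro a ⟨-, ha⟩ b ⟨-, hb⟩
    rw [pi_norm_le_iff_of_nonneg (norm_nonneg _)]
    intro i
    refine Fin.lastCases ?_ (fun j => ?_) i
    · simp [ha, hb]
    · exact norm_le_pi_norm (initL M a - initL M b) j)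
  refine measure_mono_null ?_ this
  intro y hy
  refine ⟨_, ⟨hy, ?_⟩, ?_⟩
  · simp [MeasurableEquiv.piFinSuccAbove, Fin.insertNthEquiv]
  · ext i
    simp [MeasurableEquiv.piFinSuccAbove, Fin.insertNthEquiv]

/-- Preimages of null sets under all iterates are null, so almost every orbit stays in `G` and is
never trapped in the neighbourhood `U`. A convergent orbit would be trapped after finitely many
steps. The point `x₀` itself need not lie in `G`; the equilibrium does not lie in the set to which
this is applied. -/
theorem exists_orbit_not_tendsto {M : ℕ} {T : (Fin (M + 1) → ℝ) → (Fin (M + 1) → ℝ)}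
    (hTm : Measurable T) {x₀ : Fin (M + 1) → ℝ} (K : (Fin M → ℝ) →L[ℝ] (Fin (M + 1) → ℝ))
    (hT : HasStrictFDerivAt T (K.comp (initL M)) x₀) (hdet : 1 < |((initL M).comp K).det|)
    {G : Set (Fin (M + 1) → ℝ)} (hG : volume Gᶜ = 0)
    (hGT : ∀ x ∈ G, ∃ T' : (Fin (M + 1) → ℝ) →L[ℝ] (Fin (M + 1) → ℝ),
      HasStrictFDerivAt T T' x ∧ T'.det ≠ 0)
    {V : Set (Fin (M + 1) → ℝ)} (hV : V ∈ 𝓝 x₀) :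
    ∃ x ∈ V, x ≠ x₀ ∧ (∀ k, T^[k] x ∈ G) ∧ ¬ Tendsto (fun k => T^[k] x) atTop (𝓝 x₀) := by
  have hpre : ∀ W : Set (Fin (M + 1) → ℝ), volume W = 0 → volume (T ⁻¹' W) = 0 := by
    intro W hW
    refine measure_mono_null (t := (T ⁻¹' W ∩ G) ∪ Gᶜ) ?_
      (measure_union_null (measure_preimage_inter_eq_zero volume hGT hW) hG)
    intro x hx
    by_cases h : x ∈ G
    · exact Or.inl ⟨hx, h⟩
    · exact Or.inr h
  have hpreIter : ∀ k, ∀ W : Set (Fin (M + 1) → ℝ), volume W = 0 → volume (T^[k] ⁻¹' W) = 0 := by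
    intro k
    induction k with
    | zero => intro W hW; exact hW
    | succ k ih =>
      intro W hW
      rw [Function.iterate_succ', Set.preimage_comp]
      exact ih _ (hpre W hW)
  obtain ⟨U, hU, hW⟩ := exists_nhds_measure_orbits_eq_zero hTm K hT hdet
  by_contra! hcon
  have hsub : V ⊆ {x₀} ∪ ((⋃ k, T^[k] ⁻¹' Gᶜ) ∪ ⋃ k, T^[k] ⁻¹' {x | ∀ j, T^[j] x ∈ U}) := by
    intro x hx
    by_cases hx0 : x = x₀
    · exact Or.inl hx0
    refine Or.inr ?_
    by_cases hxG : ∀ k, T^[k] x ∈ G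
    · refine Or.inr ?_
      obtain ⟨k, hk⟩ := eventually_atTop.1 ((hcon x hx hx0 hxG).eventually_mem hU)
      refine Set.mem_iUnion.2 ⟨k, fun j => ?_⟩
      rw [← Function.iterate_add_apply]
      exact hk _ (by omega)
    · push Not at hxG
      obtain ⟨k, hk⟩ := hxG
      exact Or.inl (Set.mem_iUnion.2 ⟨k, hk⟩)
  have hpos := Measure.measure_pos_of_mem_nhds (volume : Measure (Fin (M + 1) → ℝ)) hV
  refine hpos.ne' (measure_mono_null hsub (measure_union_null (by simp) (measure_union_null ?_ ?_)))
  · exact measure_iUnion_null fun k => hpreIter k _ hG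
  · exact measure_iUnion_null fun k => hpreIter k _ hW

end Orbits

/-! ### Determinants of composed linear recursions -/

section Determinant

theorem det_eq_prod_of_lower {M : ℕ} (f : (Fin M → ℝ) →ₗ[ℝ] (Fin M → ℝ)) (d : Fin M → ℝ)
    (hf : ∀ h i, (∀ j < i, h j = 0) → f h i = d i * h i) : LinearMap.det f = ∏ i, d i := by
  rw [← LinearMap.det_toMatrix', Matrix.det_of_isLowerTriangular]
  · refine Finset.prod_congr rfl fun i _ => ?_
    rw [LinearMap.toMatrix'_apply, hf]
    · simp
    · intro j hj
      simp [hj.ne]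
  · intro i j hij
    have hij : i < j := hij
    rw [LinearMap.toMatrix'_apply, hf]
    · simp [hij.ne]
    · intro k hk
      simp [(hk.trans hij).ne]

theorem det_eq_prod_of_upper {M : ℕ} (f : (Fin M → ℝ) →ₗ[ℝ] (Fin M → ℝ)) (d : Fin M → ℝ)
    (hf : ∀ h i, (∀ j, i < j → h j = 0) → f h i = d i * h i) : LinearMap.det f = ∏ i, d i := by
  rw [← LinearMap.det_toMatrix', Matrix.det_of_isUpperTriangular]
  · refine Finset.prod_congr rfl fun i _ => ?_
    rw [LinearMap.toMatrix'_apply, hf]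
    · simp
    · intro j hj
      simp [hj.ne']
  · intro i j hij
    have hij : j < i := hij
    rw [LinearMap.toMatrix'_apply, hf]
    · simp [hij.ne']
    · intro k hk
      simp [(hij.trans hk).ne']

/-- The solution of `s_{n+1} = D_n h_n + E_n s_n` that starts at `0`. -/
noncomputable def fwdScan {M : ℕ} (D E h : Fin M → ℝ) : Fin (M + 1) → ℝ :=
  Fin.induction (motive := fun _ => ℝ) 0 (fun n s => D n * h n + E n * s)

/-- The solution of `a_n = H_n y_n + I_n a_{n+1}` that ends at `z`. -/
noncomputable def bwdScan {M : ℕ} (H I y : Fin M → ℝ) (z : ℝ) : Fin (M + 1) → ℝ :=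
  Fin.reverseInduction (motive := fun _ => ℝ) z (fun n a => H n * y n + I n * a)

section

variable {M : ℕ} (D E h H I y : Fin M → ℝ) (z : ℝ)

@[simp] theorem fwdScan_zero : fwdScan D E h 0 = 0 := rfl

@[simp] theorem fwdScan_succ (n : Fin M) :
    fwdScan D E h n.succ = D n * h n + E n * fwdScan D E h n.castSucc :=
  Fin.induction_succ (motive := fun _ => ℝ) _ _ n

@[simp] theorem bwdScan_last : bwdScan H I y z (Fin.last M) = z :=
  Fin.reverseInduction_last

@[simp] theorem bwdScan_castSucc (n : Fin M) :
    bwdScan H I y z n.castSucc = H n * y n + I n * bwdScan H I y z n.succ :=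
  Fin.reverseInduction_castSucc n

theorem fwdScan_unique {s : Fin (M + 1) → ℝ} (h0 : s 0 = 0)
    (hs : ∀ n : Fin M, s n.succ = D n * h n + E n * s n.castSucc) : s = fwdScan D E h := by
  ext n
  induction n using Fin.induction with
  | zero => simp [h0]
  | succ n ih => simp [hs, ih]

theorem bwdScan_unique {a : Fin (M + 1) → ℝ} (h0 : a (Fin.last M) = z)
    (hs : ∀ n : Fin M, a n.castSucc = H n * y n + I n * a n.succ) : a = bwdScan H I y z := by
  ext n
  induction n using Fin.reverseInduction with
  | last => simp [h0]
  | cast n ih => simp [hs, ih]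

theorem fwdScan_add (h' : Fin M → ℝ) :
    fwdScan D E (h + h') = fwdScan D E h + fwdScan D E h' :=
  (fwdScan_unique _ _ _ (by simp) (fun n => by simp; ring)).symm

theorem fwdScan_smul (c : ℝ) : fwdScan D E (c • h) = c • fwdScan D E h :=
  (fwdScan_unique _ _ _ (by simp) (fun n => by simp; ring)).symm

theorem bwdScan_add (y' : Fin M → ℝ) (z' : ℝ) :
    bwdScan H I (y + y') (z + z') = bwdScan H I y z + bwdScan H I y' z' :=
  (bwdScan_unique _ _ _ _ (by simp) (fun n => by simp; ring)).symm

theorem bwdScan_smul (c : ℝ) : bwdScan H I (c • y) (c * z) = c • bwdScan H I y z :=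
  (bwdScan_unique _ _ _ _ (by simp) (fun n => by simp; ring)).symm

theorem fwdScan_eq_zero {i : Fin M} (hh : ∀ j < i, h j = 0) :
    ∀ n : Fin (M + 1), n ≤ i.castSucc → fwdScan D E h n = 0 := by
  intro n
  induction n using Fin.induction with
  | zero => simp
  | succ n ih =>
    intro hn
    have hn' : n < i := by
      rw [Fin.le_def] at hn; rw [Fin.lt_def]; simpa using hn
    rw [fwdScan_succ, hh n hn', ih (by rw [Fin.le_def]; simpa using hn'.le)]
    simp

theorem bwdScan_eq_zero {i : Fin M} (hh : ∀ j, i < j → y j = 0) :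
    ∀ n : Fin (M + 1), i.succ ≤ n → bwdScan H I y 0 n = 0 := by
  intro n
  induction n using Fin.reverseInduction with
  | last => simp
  | cast n ih =>
    intro hn
    have hn' : i < n := by
      rw [Fin.le_def] at hn; rw [Fin.lt_def]; simp at hn; omega
    rw [bwdScan_castSucc, hh n hn', ih (by rw [Fin.le_def]; simpa using hn'.le)]
    simp

end

/-- `h ↦ (A_n h_n + C_n s_n)_n`, where `s = fwdScan D E h`. -/
noncomputable def lowerMap {M : ℕ} (A C D E : Fin M → ℝ) : (Fin M → ℝ) →ₗ[ℝ] (Fin M → ℝ) where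
  toFun h n := A n * h n + C n * fwdScan D E h n.castSucc
  map_add' h h' := by ext n; simp [fwdScan_add]; ring
  map_smul' c h := by ext n; simp [fwdScan_smul]; ring

/-- `y ↦ (F_n y_n + G_n a_{n+1})_n`, where `a = bwdScan H I y 0`. -/
noncomputable def upperMap {M : ℕ} (F G H I : Fin M → ℝ) : (Fin M → ℝ) →ₗ[ℝ] (Fin M → ℝ) where
  toFun y n := F n * y n + G n * bwdScan H I y 0 n.succ
  map_add' h h' := by
    ext n
    have := congrFun (bwdScan_add H I h 0 h' 0) n.succ
    simp only [add_zero] at this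
    simp [this]; ring
  map_smul' c h := by
    ext n
    have := congrFun (bwdScan_smul H I h 0 c) n.succ
    simp only [mul_zero] at this
    simp [this]; ring

theorem lowerMap_apply {M : ℕ} (A C D E h : Fin M → ℝ) (n : Fin M) :
    lowerMap A C D E h n = A n * h n + C n * fwdScan D E h n.castSucc := rfl

theorem upperMap_apply {M : ℕ} (F G H I y : Fin M → ℝ) (n : Fin M) :
    upperMap F G H I y n = F n * y n + G n * bwdScan H I y 0 n.succ := rfl

theorem det_lowerMap {M : ℕ} (A C D E : Fin M → ℝ) :
    LinearMap.det (lowerMap A C D E) = ∏ n, A n :=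
  det_eq_prod_of_lower _ _ fun h i hi => by
    rw [lowerMap_apply, fwdScan_eq_zero D E h hi _ le_rfl]; ring

theorem det_upperMap {M : ℕ} (F G H I : Fin M → ℝ) :
    LinearMap.det (upperMap F G H I) = ∏ n, F n :=
  det_eq_prod_of_upper _ _ fun h i hi => by
    rw [upperMap_apply, bwdScan_eq_zero H I h hi _ le_rfl]; ring

/-- A composition of a forward and a backward linear recursion, coupled at the end, expands the
volume if the product of the diagonal coefficients is large. -/
theorem one_lt_abs_det_of_scan {M : ℕ} {A C D E F G H I : Fin M → ℝ} {θ : ℝ}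
    (hA : ∀ n, 0 < A n) (hC : ∀ n, 0 < C n) (hD : ∀ n, D n < 0) (hE : ∀ n, 0 < E n)
    (hF : ∀ n, F n < 0) (hG : ∀ n, G n < 0) (hH : ∀ n, H n < 0) (hI : ∀ n, 0 < I n)
    (hθ : 0 < θ) (hprod : 1 < |∏ n, A n * F n|) (J : (Fin M → ℝ) →ₗ[ℝ] (Fin M → ℝ))
    (hJ : ∀ h n, J h n = F n * lowerMap A C D E h n + G n * bwdScan H I (lowerMap A C D E h)
      (-θ * fwdScan D E h (Fin.last M)) n.succ) :
    1 < |LinearMap.det J| := by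
  have hdetY : LinearMap.det (lowerMap A C D E) ≠ 0 := by
    rw [det_lowerMap]; exact Finset.prod_ne_zero_iff.2 fun n _ => (hA n).ne'
  have hdetU : LinearMap.det (upperMap F G H I) ≠ 0 := by
    rw [det_upperMap]; exact Finset.prod_ne_zero_iff.2 fun n _ => (hF n).ne
  -- `b` is the output caused by a unit terminal value. Pulling it back through both triangular
  -- maps, to `p` and then `q`, gives `J = U L (1 + ζ ⊗ q)` with `U` and `L` the upper and lower
  -- maps, so `det J = det U * det L * (1 + ζ q)`. It remains to see `ζ q ≥ 0`.
  set b : Fin M → ℝ := fun n => G n * bwdScan H I 0 1 n.succ with hb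
  obtain ⟨p, hp⟩ := (LinearEquiv.ofIsUnitDet (f := upperMap F G H I)
    (v := Pi.basisFun ℝ (Fin M)) (v' := Pi.basisFun ℝ (Fin M))
    (by rw [LinearMap.det_toMatrix]; exact hdetU.isUnit)).surjective b
  obtain ⟨q, hq⟩ := (LinearEquiv.ofIsUnitDet (f := lowerMap A C D E)
    (v := Pi.basisFun ℝ (Fin M)) (v' := Pi.basisFun ℝ (Fin M))
    (by rw [LinearMap.det_toMatrix]; exact hdetY.isUnit)).surjective p
  change upperMap F G H I p = b at hp
  change lowerMap A C D E q = p at hq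
  let ζ : (Fin M → ℝ) →ₗ[ℝ] ℝ :=
    { toFun := fun h => -θ * fwdScan D E h (Fin.last M)
      map_add' := fun h h' => by simp [fwdScan_add]; ring
      map_smul' := fun c h => by simp [fwdScan_smul]; ring }
  have hζ : ∀ h, ζ h = -θ * fwdScan D E h (Fin.last M) := fun h => rfl
  have hJeq : J = upperMap F G H I ∘ₗ lowerMap A C D E ∘ₗ LinearMap.transvection ζ q := by
    ext1 j
    ext n
    simp only [LinearMap.comp_apply, LinearMap.transvection.apply, map_add, map_smul, hq, hp]
    generalize LinearMap.single ℝ (fun _ : Fin M => ℝ) j 1 = h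
    rw [hJ, ← hζ]
    have h1 := congrFun (bwdScan_add H I (lowerMap A C D E h) 0 0 (ζ h)) n.succ
    have h2 := congrFun (bwdScan_smul H I 0 1 (ζ h)) n.succ
    simp only [add_zero, zero_add, smul_zero, mul_one] at h1 h2
    rw [h1, Pi.add_apply, Pi.add_apply, h2, upperMap_apply]
    simp [hb]; ring
  have hw : ∀ n : Fin (M + 1), 0 < bwdScan H I (-p) 1 n := by
    have hpn : ∀ n : Fin M, F n * p n = G n * bwdScan H I (-p) 1 n.succ := by
      intro n
      have h1 := congrFun hp n
      have h2 := congrFun (bwdScan_add H I p 0 (-p) 1) n.succ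
      rw [upperMap_apply] at h1
      simp only [hb, add_neg_cancel, zero_add, Pi.add_apply] at h1 h2
      rw [h2] at h1
      linarith
    intro n
    induction n using Fin.reverseInduction with
    | last => simp
    | cast n ih =>
      have h1 : 0 < p n := by
        have := hpn n
        have h3 : G n * bwdScan H I (-p) 1 n.succ < 0 := mul_neg_of_neg_of_pos (hG n) ih
        rw [← this] at h3
        exact pos_of_mul_neg_right h3 (hF n).le
      rw [bwdScan_castSucc, Pi.neg_apply]
      have := mul_neg_of_neg_of_pos (hH n) h1
      have := mul_pos (hI n) ih
      linarith
  have hppos : ∀ n, 0 < p n := by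
    intro n
    have h1 := congrFun hp n
    have h2 := congrFun (bwdScan_add H I p 0 (-p) 1) n.succ
    rw [upperMap_apply] at h1
    simp only [hb, add_neg_cancel, zero_add, Pi.add_apply] at h1 h2
    rw [h2] at h1
    have h3 : G n * bwdScan H I (-p) 1 n.succ < 0 := mul_neg_of_neg_of_pos (hG n) (hw _)
    exact pos_of_mul_neg_right (a := F n) (by linarith) (hF n).le
  -- As long as the scan is nonpositive, `A q = p - C s` forces `q > 0`, and `D < 0` keeps the scan
  -- nonpositive.
  have hs : ∀ n : Fin (M + 1), fwdScan D E q n ≤ 0 := by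
    intro n
    induction n using Fin.induction with
    | zero => simp
    | succ n ih =>
      have h1 := congrFun hq n
      rw [lowerMap_apply] at h1
      have hqn : 0 < q n := by
        have h2 := mul_nonpos_of_nonneg_of_nonpos (hC n).le ih
        have h3 := hppos n
        exact pos_of_mul_pos_right (a := A n) (by linarith) (hA n).le
      rw [fwdScan_succ]
      have h2 := mul_neg_of_neg_of_pos (hD n) hqn
      have h3 := mul_nonpos_of_nonneg_of_nonpos (hE n).le ih
      linarith
  have hζq : 0 ≤ ζ q := by
    rw [hζ]
    have := hs (Fin.last M)
    nlinarith
  rw [hJeq, LinearMap.det_comp, LinearMap.det_comp, LinearMap.transvection.det, det_lowerMap,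
    det_upperMap, ← mul_assoc, abs_mul, ← Finset.prod_mul_distrib]
  simp_rw [mul_comm (F _)]
  rw [abs_of_nonneg (by linarith : 0 ≤ 1 + ζ q)]
  nlinarith

end Determinant

/-! ### Unfolding and positivity of the recursions -/

section Recursions

variable {N : ℕ} (Δ σ S₀ : ℝ) (β lam : Fin N → ℝ)

@[simp] theorem condVar_zero : condVar Δ σ S₀ β 0 = S₀ := rfl

theorem condVar_succ (n : Fin N) :
    condVar Δ σ S₀ β n.succ = condVar Δ σ S₀ β n.castSucc * σ ^ 2 /
      (β n ^ 2 * condVar Δ σ S₀ β n.castSucc * Δ + σ ^ 2) :=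
  Fin.induction_succ (motive := fun _ => ℝ) _ _ n

@[simp] theorem valueCoeff_last : valueCoeff lam (Fin.last N) = 0 :=
  Fin.reverseInduction_last

theorem valueCoeff_castSucc (n : Fin N) :
    valueCoeff lam n.castSucc = 1 / (4 * lam n * (1 - valueCoeff lam n.succ * lam n)) :=
  Fin.reverseInduction_castSucc n

variable {Δ σ S₀}

theorem denom_pos (hΔ : 0 < Δ) (hσ : 0 < σ) {s : ℝ} (hs : 0 < s) (b : ℝ) :
    0 < b ^ 2 * s * Δ + σ ^ 2 := by positivity

theorem condVar_pos (hΔ : 0 < Δ) (hσ : 0 < σ) (hS₀ : 0 < S₀) (n : Fin (N + 1)) :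
    0 < condVar Δ σ S₀ β n := by
  induction n using Fin.induction with
  | zero => simpa
  | succ n ih =>
    rw [condVar_succ]
    have := denom_pos hΔ hσ ih (β n)
    positivity

end Recursions

/-! ### Measurability, meromorphy along lines and smoothness -/

section Regularity

variable {N : ℕ} {Δ σ S₀ : ℝ}

theorem measurable_condVar (n : Fin (N + 1)) :
    Measurable fun β : Fin N → ℝ => condVar Δ σ S₀ β n := by
  induction n using Fin.induction with
  | zero => simp
  | succ n ih => simp only [condVar_succ]; fun_prop

theorem measurable_kyleLambda (n : Fin N) :
    Measurable fun β : Fin N → ℝ => kyleLambda Δ σ S₀ β n := by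
  have := measurable_condVar (Δ := Δ) (σ := σ) (S₀ := S₀) n.castSucc
  unfold kyleLambda; fun_prop

theorem measurable_valueCoeff (n : Fin (N + 1)) :
    Measurable fun lam : Fin N → ℝ => valueCoeff lam n := by
  induction n using Fin.reverseInduction with
  | last => simp
  | cast n ih => simp only [valueCoeff_castSucc]; fun_prop

theorem measurable_T : Measurable (T Δ σ S₀ : (Fin N → ℝ) → Fin N → ℝ) := by
  have h1 : Measurable (kyleLambda Δ σ S₀ : (Fin N → ℝ) → Fin N → ℝ) :=
    measurable_pi_iff.2 measurable_kyleLambda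
  refine Measurable.comp (g := bestResponse Δ) (measurable_pi_iff.2 fun n => ?_) h1
  have := measurable_valueCoeff n.succ
  unfold bestResponse; fun_prop

theorem meromorphic_condVar {β : ℝ → Fin N → ℝ} (hβ : ∀ n, Meromorphic fun t => β t n)
    (n : Fin (N + 1)) : Meromorphic fun t => condVar Δ σ S₀ (β t) n := by
  induction n using Fin.induction with
  | zero => simp only [condVar_zero]; exact Meromorphic.const _
  | succ n ih =>
    simp only [condVar_succ]
    intro t
    have h1 := hβ n t
    have h2 := ih t
    fun_prop

theorem meromorphic_kyleLambda {β : ℝ → Fin N → ℝ} (hβ : ∀ n, Meromorphic fun t => β t n)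
    (n : Fin N) : Meromorphic fun t => kyleLambda Δ σ S₀ (β t) n := by
  unfold kyleLambda
  intro t
  have h1 := hβ n t
  have h2 := meromorphic_condVar (Δ := Δ) (σ := σ) (S₀ := S₀) hβ n.castSucc t
  fun_prop

theorem meromorphic_valueCoeff {lam : ℝ → Fin N → ℝ} (hlam : ∀ n, Meromorphic fun t => lam t n)
    (n : Fin (N + 1)) : Meromorphic fun t => valueCoeff (lam t) n := by
  induction n using Fin.reverseInduction with
  | last => simp only [valueCoeff_last]; exact Meromorphic.const _
  | cast n ih =>
    simp only [valueCoeff_castSucc]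
    intro t
    have h1 := hlam n t
    have h2 := ih t
    fun_prop

theorem contDiff_condVar (hΔ : 0 < Δ) (hσ : 0 < σ) (hS₀ : 0 < S₀) (n : Fin (N + 1)) :
    ContDiff ℝ 1 fun β : Fin N → ℝ => condVar Δ σ S₀ β n := by
  induction n using Fin.induction with
  | zero => simp only [condVar_zero]; fun_prop
  | succ n ih =>
    simp only [condVar_succ]
    exact ContDiff.div (by fun_prop) (by fun_prop) fun β =>
      (denom_pos hΔ hσ (condVar_pos β hΔ hσ hS₀ _) _).ne'

theorem contDiff_kyleLambda (hΔ : 0 < Δ) (hσ : 0 < σ) (hS₀ : 0 < S₀) :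
    ContDiff ℝ 1 (kyleLambda Δ σ S₀ : (Fin N → ℝ) → Fin N → ℝ) := by
  refine contDiff_pi.2 fun n => ?_
  have := contDiff_condVar hΔ hσ hS₀ n.castSucc
  unfold kyleLambda
  exact ContDiff.div (by fun_prop) (by fun_prop) fun β =>
      (denom_pos hΔ hσ (condVar_pos β hΔ hσ hS₀ _) _).ne'

/-- The pricing coefficients at which the insider's problem is regular. -/
def RegularPricing (lam : Fin N → ℝ) : Prop :=
  ∀ n : Fin N, lam n ≠ 0 ∧ 1 - valueCoeff lam n.succ * lam n ≠ 0

theorem contDiffAt_valueCoeff {lam : Fin N → ℝ} (h : RegularPricing lam) (n : Fin (N + 1)) :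
    ContDiffAt ℝ 1 (fun lam : Fin N → ℝ => valueCoeff lam n) lam := by
  induction n using Fin.reverseInduction with
  | last => simp only [valueCoeff_last]; fun_prop
  | cast n ih =>
    simp only [valueCoeff_castSucc]
    exact ContDiffAt.div (by fun_prop) (by fun_prop)
      (mul_ne_zero (mul_ne_zero (by norm_num) (h n).1) (h n).2)

theorem contDiffAt_bestResponse (hΔ : 0 < Δ) {lam : Fin N → ℝ} (h : RegularPricing lam) :
    ContDiffAt ℝ 1 (bestResponse Δ : (Fin N → ℝ) → Fin N → ℝ) lam := by
  refine contDiffAt_pi.2 fun n => ?_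
  have := contDiffAt_valueCoeff h n.succ
  unfold bestResponse
  exact ContDiffAt.div (by fun_prop) (by fun_prop)
    (mul_ne_zero (mul_ne_zero (by positivity) (h n).1) (h n).2)

end Regularity

section Derivatives

/-! The partial derivatives of the two steps of the recursions. -/

variable (Δ σ : ℝ)

/-- Derivatives in (intensity, variance): `A`, `C` for the pricing coefficient, `D`, `E` for the
next variance. Derivatives in (pricing coefficient, value coefficient): `F`, `G` for the best
response, `H`, `I` for the previous value coefficient. -/
noncomputable def coeffA (b s : ℝ) : ℝ := s * (σ ^ 2 - b ^ 2 * s * Δ) / (b ^ 2 * s * Δ + σ ^ 2) ^ 2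
noncomputable def coeffC (b s : ℝ) : ℝ := b * σ ^ 2 / (b ^ 2 * s * Δ + σ ^ 2) ^ 2
noncomputable def coeffD (b s : ℝ) : ℝ :=
  -(2 * b * s ^ 2 * Δ * σ ^ 2) / (b ^ 2 * s * Δ + σ ^ 2) ^ 2
noncomputable def coeffE (b s : ℝ) : ℝ := σ ^ 4 / (b ^ 2 * s * Δ + σ ^ 2) ^ 2
noncomputable def coeffF (l a : ℝ) : ℝ :=
  -((1 - a * l) ^ 2 + (a * l) ^ 2) / (2 * Δ * l ^ 2 * (1 - a * l) ^ 2)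
noncomputable def coeffG (l a : ℝ) : ℝ := -1 / (2 * Δ * (1 - a * l) ^ 2)
noncomputable def coeffH (l a : ℝ) : ℝ := -(1 - 2 * a * l) / (4 * l ^ 2 * (1 - a * l) ^ 2)
noncomputable def coeffI (l a : ℝ) : ℝ := 1 / (4 * (1 - a * l) ^ 2)

variable {Δ σ} {f g : ℝ → ℝ} {f' g' t : ℝ}

theorem hasDerivAt_lambda_step (hf : HasDerivAt f f' t) (hg : HasDerivAt g g' t)
    (h : f t ^ 2 * g t * Δ + σ ^ 2 ≠ 0) :
    HasDerivAt (fun t => f t * g t / (f t ^ 2 * g t * Δ + σ ^ 2))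
      (coeffA Δ σ (f t) (g t) * f' + coeffC Δ σ (f t) (g t) * g') t := by
  convert! (hf.mul hg).div ((((hf.pow 2).mul hg).mul_const Δ).add_const (σ ^ 2)) h using 1
  simp only [coeffA, coeffC, Pi.mul_apply, Pi.pow_apply]
  field_simp
  ring

theorem hasDerivAt_condVar_step (hf : HasDerivAt f f' t) (hg : HasDerivAt g g' t)
    (h : f t ^ 2 * g t * Δ + σ ^ 2 ≠ 0) :
    HasDerivAt (fun t => g t * σ ^ 2 / (f t ^ 2 * g t * Δ + σ ^ 2))
      (coeffD Δ σ (f t) (g t) * f' + coeffE Δ σ (f t) (g t) * g') t := by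
  convert! (hg.mul_const (σ ^ 2)).div ((((hf.pow 2).mul hg).mul_const Δ).add_const (σ ^ 2)) h
    using 1
  simp only [coeffD, coeffE, Pi.mul_apply, Pi.pow_apply]
  field_simp
  ring

theorem hasDerivAt_bestResponse_step (hΔ : Δ ≠ 0) (hf : HasDerivAt f f' t)
    (hg : HasDerivAt g g' t) (h1 : f t ≠ 0) (h2 : 1 - g t * f t ≠ 0) :
    HasDerivAt (fun t => (1 - 2 * g t * f t) / (2 * Δ * f t * (1 - g t * f t)))
      (coeffF Δ (f t) (g t) * f' + coeffG Δ (f t) (g t) * g') t := by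
  convert! (((hg.const_mul 2).mul hf).const_sub 1).div
    ((hf.const_mul (2 * Δ)).mul ((hg.mul hf).const_sub 1))
    (mul_ne_zero (mul_ne_zero (mul_ne_zero two_ne_zero hΔ) h1) h2) using 1
  simp only [coeffF, coeffG, Pi.mul_apply]
  field_simp
  ring

theorem hasDerivAt_valueCoeff_step (hf : HasDerivAt f f' t)
    (hg : HasDerivAt g g' t) (h1 : f t ≠ 0) (h2 : 1 - g t * f t ≠ 0) :
    HasDerivAt (fun t => 1 / (4 * f t * (1 - g t * f t)))
      (coeffH (f t) (g t) * f' + coeffI (f t) (g t) * g') t := by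
  convert! (hasDerivAt_const t (1 : ℝ)).div
    ((hf.const_mul 4).mul ((hg.mul hf).const_sub 1))
    (mul_ne_zero (mul_ne_zero four_ne_zero h1) h2) using 1
  simp only [coeffH, coeffI, Pi.mul_apply]
  field_simp
  ring

end Derivatives

/-! ### The derivative of `T` and its generic invertibility -/

section DerivativeOfT

variable {N : ℕ} {Δ σ S₀ : ℝ}

/-- Differentiating the recursion along the line `β + t h` shows that the directional derivatives
satisfy the linearised recursion, which determines them. -/
theorem fderiv_condVar (hΔ : 0 < Δ) (hσ : 0 < σ) (hS₀ : 0 < S₀) (β h : Fin N → ℝ) :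
    (fun n => fderiv ℝ (fun β : Fin N → ℝ => condVar Δ σ S₀ β n) β h) =
      fwdScan (fun n => coeffD Δ σ (β n) (condVar Δ σ S₀ β n.castSucc))
        (fun n => coeffE Δ σ (β n) (condVar Δ σ S₀ β n.castSucc)) h := by
  refine fwdScan_unique _ _ _ (by simp) fun n => ?_
  have hd : ∀ n, HasDerivAt (fun t : ℝ => condVar Δ σ S₀ (β + t • h) n)
      (fderiv ℝ (fun β : Fin N → ℝ => condVar Δ σ S₀ β n) β h) 0 := fun n =>
    (((contDiff_condVar hΔ hσ hS₀ n).differentiable one_ne_zero β).hasFDerivAt.hasLineDerivAt h)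
  have hb : HasDerivAt (fun t : ℝ => (β + t • h) n) (h n) 0 := by
    simpa using ((hasDerivAt_id (0 : ℝ)).mul_const (h n)).const_add (β n)
  have h1 := hd n.succ
  simp only [condVar_succ] at h1
  have h2 := hasDerivAt_condVar_step (Δ := Δ) (σ := σ) hb (hd n.castSucc)
    (denom_pos hΔ hσ (condVar_pos _ hΔ hσ hS₀ _) _).ne'
  have h3 := h1.unique h2
  simp only [zero_smul, add_zero, condVar_succ] at h3 ⊢
  exact h3

theorem fderiv_kyleLambda (hΔ : 0 < Δ) (hσ : 0 < σ) (hS₀ : 0 < S₀) (β h : Fin N → ℝ) (n : Fin N) :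
    fderiv ℝ (kyleLambda Δ σ S₀) β h n =
      lowerMap (fun n => coeffA Δ σ (β n) (condVar Δ σ S₀ β n.castSucc))
        (fun n => coeffC Δ σ (β n) (condVar Δ σ S₀ β n.castSucc))
        (fun n => coeffD Δ σ (β n) (condVar Δ σ S₀ β n.castSucc))
        (fun n => coeffE Δ σ (β n) (condVar Δ σ S₀ β n.castSucc)) h n := by
  have hd : HasDerivAt (fun t : ℝ => condVar Δ σ S₀ (β + t • h) n.castSucc)
      (fderiv ℝ (fun β : Fin N → ℝ => condVar Δ σ S₀ β n.castSucc) β h) 0 :=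
    (((contDiff_condVar hΔ hσ hS₀ _).differentiable one_ne_zero β).hasFDerivAt.hasLineDerivAt h)
  have hb : HasDerivAt (fun t : ℝ => (β + t • h) n) (h n) 0 := by
    simpa using ((hasDerivAt_id (0 : ℝ)).mul_const (h n)).const_add (β n)
  have hl : HasDerivAt (fun t : ℝ => kyleLambda Δ σ S₀ (β + t • h))
      (fderiv ℝ (kyleLambda Δ σ S₀) β h) 0 :=
    (((contDiff_kyleLambda hΔ hσ hS₀).differentiable one_ne_zero β).hasFDerivAt.hasLineDerivAt h)
  have h1 := hasDerivAt_pi.1 hl n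
  have h2 := hasDerivAt_lambda_step (Δ := Δ) (σ := σ) hb hd
    (denom_pos hΔ hσ (condVar_pos _ hΔ hσ hS₀ _) _).ne'
  have h3 := h1.unique h2
  rw [lowerMap_apply, ← fderiv_condVar hΔ hσ hS₀]
  simp only [zero_smul, add_zero] at h3
  exact h3

theorem fderiv_valueCoeff {lam : Fin N → ℝ} (hlam : RegularPricing lam) (k : Fin N → ℝ) :
    (fun n => fderiv ℝ (fun lam : Fin N → ℝ => valueCoeff lam n) lam k) =
      bwdScan (fun n => coeffH (lam n) (valueCoeff lam n.succ))
        (fun n => coeffI (lam n) (valueCoeff lam n.succ)) k 0 := by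
  refine bwdScan_unique _ _ _ _ (by simp) fun n => ?_
  have hd : ∀ n, HasDerivAt (fun t : ℝ => valueCoeff (lam + t • k) n)
      (fderiv ℝ (fun lam : Fin N → ℝ => valueCoeff lam n) lam k) 0 := fun n =>
    (((contDiffAt_valueCoeff hlam n).differentiableAt one_ne_zero).hasFDerivAt.hasLineDerivAt k)
  have hb : HasDerivAt (fun t : ℝ => (lam + t • k) n) (k n) 0 := by
    simpa using ((hasDerivAt_id (0 : ℝ)).mul_const (k n)).const_add (lam n)
  have h1 := hd n.castSucc
  simp only [valueCoeff_castSucc] at h1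
  have h2 := hasDerivAt_valueCoeff_step hb (hd n.succ)
    (by simpa using (hlam n).1) (by simpa using (hlam n).2)
  have h3 := h1.unique h2
  simp only [zero_smul, add_zero, valueCoeff_castSucc] at h3 ⊢
  exact h3

theorem fderiv_bestResponse (hΔ : 0 < Δ) {lam : Fin N → ℝ} (hlam : RegularPricing lam)
    (k : Fin N → ℝ) (n : Fin N) :
    fderiv ℝ (bestResponse Δ) lam k n =
      upperMap (fun n => coeffF Δ (lam n) (valueCoeff lam n.succ))
        (fun n => coeffG Δ (lam n) (valueCoeff lam n.succ))
        (fun n => coeffH (lam n) (valueCoeff lam n.succ))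
        (fun n => coeffI (lam n) (valueCoeff lam n.succ)) k n := by
  have hd : HasDerivAt (fun t : ℝ => valueCoeff (lam + t • k) n.succ)
      (fderiv ℝ (fun lam : Fin N → ℝ => valueCoeff lam n.succ) lam k) 0 :=
    (((contDiffAt_valueCoeff hlam _).differentiableAt one_ne_zero).hasFDerivAt.hasLineDerivAt k)
  have hb : HasDerivAt (fun t : ℝ => (lam + t • k) n) (k n) 0 := by
    simpa using ((hasDerivAt_id (0 : ℝ)).mul_const (k n)).const_add (lam n)
  have hl : HasDerivAt (fun t : ℝ => bestResponse Δ (lam + t • k))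
      (fderiv ℝ (bestResponse Δ) lam k) 0 :=
    (((contDiffAt_bestResponse hΔ hlam).differentiableAt
      one_ne_zero).hasFDerivAt.hasLineDerivAt k)
  have h1 := hasDerivAt_pi.1 hl n
  have h2 := hasDerivAt_bestResponse_step hΔ.ne' hb hd
    (by simpa using (hlam n).1) (by simpa using (hlam n).2)
  have h3 := h1.unique h2
  rw [upperMap_apply, ← fderiv_valueCoeff hlam]
  simp only [zero_smul, add_zero] at h3
  exact h3

theorem hasStrictFDerivAt_T (hΔ : 0 < Δ) (hσ : 0 < σ) (hS₀ : 0 < S₀) {β : Fin N → ℝ}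
    (hβ : β ∈ domT Δ σ S₀ N) :
    HasStrictFDerivAt (T Δ σ S₀) ((fderiv ℝ (bestResponse Δ) (kyleLambda Δ σ S₀ β)).comp
      (fderiv ℝ (kyleLambda Δ σ S₀) β)) β :=
  HasStrictFDerivAt.comp (g := bestResponse Δ) β
    ((contDiffAt_bestResponse hΔ hβ).hasStrictFDerivAt one_ne_zero)
    ((contDiff_kyleLambda hΔ hσ hS₀).contDiffAt.hasStrictFDerivAt one_ne_zero)

theorem coeffF_neg (hΔ : 0 < Δ) {l a : ℝ} (hl : l ≠ 0) (ha : 1 - a * l ≠ 0) :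
    coeffF Δ l a < 0 := by
  unfold coeffF
  exact div_neg_of_neg_of_pos (neg_neg_of_pos (by positivity)) (by positivity)

/-- The determinant is the product of all `A_n F_n`. The numerator of `F_n` is minus a sum of two
squares that cannot both vanish, so only the folds `A_n = 0` have to be excluded. -/
theorem det_fderiv_T_ne_zero (hΔ : 0 < Δ) (hσ : 0 < σ) (hS₀ : 0 < S₀) {β : Fin N → ℝ}
    (hβ : β ∈ domT Δ σ S₀ N) (hfold : ∀ n, β n ^ 2 * condVar Δ σ S₀ β n.castSucc * Δ - σ ^ 2 ≠ 0) :
    ((fderiv ℝ (bestResponse Δ) (kyleLambda Δ σ S₀ β)).comp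
      (fderiv ℝ (kyleLambda Δ σ S₀) β)).det ≠ 0 := by
  have h1 := LinearMap.ext fun h => funext (fderiv_kyleLambda hΔ hσ hS₀ β h)
  have h2 := LinearMap.ext fun h => funext (fderiv_bestResponse hΔ hβ h)
  change LinearMap.det ((fderiv ℝ (bestResponse Δ) (kyleLambda Δ σ S₀ β)).toLinearMap ∘ₗ
    (fderiv ℝ (kyleLambda Δ σ S₀) β).toLinearMap) ≠ 0
  rw [LinearMap.det_comp, h1, h2, det_lowerMap, det_upperMap]
  refine mul_ne_zero (Finset.prod_ne_zero_iff.2 fun n _ => ?_)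
    (Finset.prod_ne_zero_iff.2 fun n _ => ?_)
  · exact (coeffF_neg hΔ (hβ n).1 (hβ n).2).ne
  · have hs := condVar_pos β hΔ hσ hS₀ n.castSucc
    unfold coeffA
    refine div_ne_zero (mul_ne_zero hs.ne' fun h => hfold n (by linarith)) ?_
    exact pow_ne_zero _ (denom_pos hΔ hσ hs _).ne'

/-- Every excluded condition is the vanishing of a function meromorphic along lines. The point `β₀`
guarantees that the denominators do not vanish identically. -/
theorem ae_mem_domT (hΔ : 0 < Δ) (hσ : 0 < σ) (hS₀ : 0 < S₀) {β₀ : Fin N → ℝ}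
    (hβ₀ : β₀ ∈ domT Δ σ S₀ N) :
    volume {β | β ∈ domT Δ σ S₀ N ∧
      ∀ n, β n ^ 2 * condVar Δ σ S₀ β n.castSucc * Δ - σ ^ 2 ≠ 0}ᶜ = 0 := by
  have hline : ∀ x d : Fin N → ℝ, ∀ n, Meromorphic fun t : ℝ => (x + t • d) n := by
    intro x d n t
    simp only [Pi.add_apply, Pi.smul_apply, smul_eq_mul]
    fun_prop
  have hlamc : Continuous (kyleLambda Δ σ S₀ : (Fin N → ℝ) → Fin N → ℝ) :=
    (contDiff_kyleLambda hΔ hσ hS₀).continuous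
  have h1 : ∀ n, volume {β : Fin N → ℝ | kyleLambda Δ σ S₀ β n = 0} = 0 := fun n =>
    measure_zeros_eq_zero_of_meromorphic volume (measurable_kyleLambda n) β₀
      (fun d => meromorphic_kyleLambda (hline β₀ d) n)
      ((continuous_apply n).comp hlamc).continuousAt (hβ₀ n).1
  have h2 : ∀ n : Fin N, volume {β : Fin N → ℝ |
      1 - valueCoeff (kyleLambda Δ σ S₀ β) n.succ * kyleLambda Δ σ S₀ β n = 0} = 0 := fun n => by
    refine measure_zeros_eq_zero_of_meromorphic volume ?_ β₀ (fun d t => ?_) ?_ (hβ₀ n).2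
    · have h3 := (measurable_valueCoeff n.succ).comp
        (measurable_pi_iff.2 (measurable_kyleLambda (Δ := Δ) (σ := σ) (S₀ := S₀)))
      have h4 := measurable_kyleLambda (Δ := Δ) (σ := σ) (S₀ := S₀) n
      exact (h3.mul h4).const_sub 1
    · have h3 := meromorphic_kyleLambda (Δ := Δ) (σ := σ) (S₀ := S₀) (hline β₀ d)
      have h4 := h3 n t
      have h5 := meromorphic_valueCoeff h3 n.succ t
      fun_prop
    · have h3 : ContinuousAt (fun β : Fin N → ℝ => valueCoeff (kyleLambda Δ σ S₀ β) n.succ) β₀ :=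
        ContinuousAt.comp (g := fun lam : Fin N → ℝ => valueCoeff lam n.succ)
          (contDiffAt_valueCoeff hβ₀ n.succ).continuousAt hlamc.continuousAt
      have h4 : ContinuousAt (fun β : Fin N → ℝ => kyleLambda Δ σ S₀ β n) β₀ :=
        ((continuous_apply n).comp hlamc).continuousAt
      exact continuousAt_const.sub (h3.mul h4)
  have h3 : ∀ n : Fin N, volume {β : Fin N → ℝ |
      β n ^ 2 * condVar Δ σ S₀ β n.castSucc * Δ - σ ^ 2 = 0} = 0 := fun n => by
    -- The base point is `0`, where the function equals `-σ ^ 2`; `β₀` may lie on a fold.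
    refine measure_zeros_eq_zero_of_meromorphic volume ?_ 0 (fun d t => ?_) ?_ ?_
    · have := measurable_condVar (Δ := Δ) (σ := σ) (S₀ := S₀) n.castSucc
      fun_prop
    · have h4 := meromorphic_condVar (Δ := Δ) (σ := σ) (S₀ := S₀) (hline 0 d) n.castSucc t
      have h5 := hline 0 d n t
      fun_prop
    · have := (contDiff_condVar hΔ hσ hS₀ n.castSucc).continuous
      fun_prop
    · simp [hσ.ne']
  refine measure_mono_null ?_ (measure_union_null (measure_union_null (measure_iUnion_null h1)
    (measure_iUnion_null h2)) (measure_iUnion_null h3))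
  intro β hβ
  by_contra hcon
  simp only [Set.mem_union, Set.mem_iUnion, Set.mem_ofPred_eq, not_or, not_exists] at hcon
  exact hβ ⟨fun n => ⟨hcon.1.1 n, hcon.1.2 n⟩, hcon.2⟩

end DerivativeOfT

/-! ### The equilibrium in terms of `q_n = α_n lam_n` -/

namespace IsEquilibrium

section

variable {N : ℕ} {Δ σ S₀ : ℝ} {lam : Fin N → ℝ} {S α : Fin (N + 1) → ℝ} {β : Fin N → ℝ}

theorem condVar_eq (h : IsEquilibrium Δ σ S₀ lam S α β) : condVar Δ σ S₀ β = S := by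
  ext n
  induction n using Fin.induction with
  | zero => simp [h.S_zero]
  | succ n ih => rw [condVar_succ, ih, h.S_eq]

theorem kyleLambda_eq (h : IsEquilibrium Δ σ S₀ lam S α β) : kyleLambda Δ σ S₀ β = lam := by
  ext n
  rw [kyleLambda, h.condVar_eq, h.lam_eq]

theorem valueCoeff_eq (h : IsEquilibrium Δ σ S₀ lam S α β) : valueCoeff lam = α := by
  ext n
  induction n using Fin.reverseInduction with
  | last => simp [h.α_last]
  | cast n ih => rw [valueCoeff_castSucc, ih, h.α_eq]

theorem mem_domT (h : IsEquilibrium Δ σ S₀ lam S α β) : β ∈ domT Δ σ S₀ N := by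
  intro n
  rw [h.kyleLambda_eq, h.valueCoeff_eq]
  have := h.second_order n
  exact ⟨(h.lam_pos n).ne', by linarith⟩

theorem S_pos (h : IsEquilibrium Δ σ S₀ lam S α β) (hΔ : 0 < Δ) (hσ : 0 < σ) (hS₀ : 0 < S₀)
    (n : Fin (N + 1)) : 0 < S n := by
  rw [← h.condVar_eq]; exact condVar_pos β hΔ hσ hS₀ n

theorem β_pos (h : IsEquilibrium Δ σ S₀ lam S α β) (hΔ : 0 < Δ) (hσ : 0 < σ) (hS₀ : 0 < S₀)
    (n : Fin N) : 0 < β n := by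
  have h1 := h.lam_pos n
  have hs := h.S_pos hΔ hσ hS₀ n.castSucc
  rw [h.lam_eq, div_pos_iff_of_pos_right (denom_pos hΔ hσ hs _)] at h1
  exact pos_of_mul_pos_left h1 hs.le

theorem two_mul_lt_one (h : IsEquilibrium Δ σ S₀ lam S α β) (hΔ : 0 < Δ) (hσ : 0 < σ)
    (hS₀ : 0 < S₀) (n : Fin N) : 2 * (α n.succ * lam n) < 1 := by
  have h1 := h.β_pos hΔ hσ hS₀ n
  have h2 := h.lam_pos n
  have h3 := h.second_order n
  rw [h.β_eq, div_pos_iff_of_pos_right] at h1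
  · linarith
  · have : 0 < 1 - α n.succ * lam n := by linarith
    positivity

theorem α_pos (h : IsEquilibrium Δ σ S₀ lam S α β) (n : Fin N) : 0 < α n.castSucc := by
  rw [h.α_eq]
  have h2 := h.lam_pos n
  have h3 : 0 < 1 - α n.succ * lam n := by linarith [h.second_order n]
  positivity

/-- Eliminating `lam_n` between its own equation and that of `β_n` leaves a linear equation for
`β_n² S_{n-1} Δ`, with coefficients in `q_n`. -/
theorem sq_mul_eq (h : IsEquilibrium Δ σ S₀ lam S α β) (hΔ : 0 < Δ) (hσ : 0 < σ)
    (hS₀ : 0 < S₀) (n : Fin N) :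
    β n ^ 2 * S n.castSucc * Δ = (1 - 2 * (α n.succ * lam n)) * σ ^ 2 := by
  have hX := (denom_pos hΔ hσ (h.S_pos hΔ hσ hS₀ n.castSucc) (β n)).ne'
  have h2 := h.lam_pos n
  have h3 : 0 < 1 - α n.succ * lam n := by linarith [h.second_order n]
  have h4 := h.lam_eq n
  have h5 := h.β_eq n
  rw [eq_div_iff hX] at h4
  rw [eq_div_iff (by positivity)] at h5
  linear_combination (β n ^ 2 * S n.castSucc * Δ + σ ^ 2) * h5 -
    2 * Δ * β n * (1 - α n.succ * lam n) * h4

theorem denom_eq (h : IsEquilibrium Δ σ S₀ lam S α β) (hΔ : 0 < Δ) (hσ : 0 < σ)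
    (hS₀ : 0 < S₀) (n : Fin N) :
    β n ^ 2 * S n.castSucc * Δ + σ ^ 2 = 2 * (1 - α n.succ * lam n) * σ ^ 2 := by
  rw [h.sq_mul_eq hΔ hσ hS₀]; ring

theorem lam_sq_eq (h : IsEquilibrium Δ σ S₀ lam S α β) (hΔ : 0 < Δ) (hσ : 0 < σ)
    (hS₀ : 0 < S₀) (n : Fin N) :
    4 * lam n ^ 2 * (1 - α n.succ * lam n) ^ 2 * σ ^ 2 * Δ =
      S n.castSucc * (1 - 2 * (α n.succ * lam n)) := by
  have hX := (denom_pos hΔ hσ (h.S_pos hΔ hσ hS₀ n.castSucc) (β n)).ne'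
  have h3 := h.denom_eq hΔ hσ hS₀ n
  have h4 := h.lam_eq n
  have h5 := h.sq_mul_eq hΔ hσ hS₀ n
  rw [eq_div_iff hX, h3] at h4
  have hσ' : σ ^ 2 ≠ 0 := by positivity
  apply mul_right_cancel₀ hσ'
  linear_combination (lam n * (2 * (1 - α n.succ * lam n) * σ ^ 2) + β n * S n.castSucc) * Δ * h4 +
    S n.castSucc * h5

theorem coeffA_mul_coeffF (h : IsEquilibrium Δ σ S₀ lam S α β) (hΔ : 0 < Δ) (hσ : 0 < σ)
    (hS₀ : 0 < S₀) (n : Fin N) :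
    coeffA Δ σ (β n) (S n.castSucc) * coeffF Δ (lam n) (α n.succ) =
      -(α n.succ * lam n * (1 - 2 * (α n.succ * lam n) + 2 * (α n.succ * lam n) ^ 2) /
        ((1 - 2 * (α n.succ * lam n)) * (1 - α n.succ * lam n) ^ 2)) := by
  have hs := h.S_pos hΔ hσ hS₀ n.castSucc
  have h1 := h.lam_sq_eq hΔ hσ hS₀ n
  have h2 := h.lam_pos n
  have h3 : 0 < 1 - α n.succ * lam n := by linarith [h.second_order n]
  have h4 : 0 < 1 - 2 * (α n.succ * lam n) := by linarith [h.two_mul_lt_one hΔ hσ hS₀ n]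
  rw [coeffA, coeffF, h.denom_eq hΔ hσ hS₀, h.sq_mul_eq hΔ hσ hS₀]
  generalize α n.succ * lam n = q at *
  have h5 : S n.castSucc = 4 * lam n ^ 2 * (1 - q) ^ 2 * σ ^ 2 * Δ / (1 - 2 * q) := by
    rw [h1]; field_simp
  rw [h5]
  field_simp
  ring

end

section

variable {M : ℕ} {Δ σ S₀ : ℝ} {lam : Fin (M + 1) → ℝ} {S α : Fin (M + 2) → ℝ}
  {β : Fin (M + 1) → ℝ}

/-- Dividing `lam_sq_eq` at two consecutive times and inserting `S_{n-1} = 2 (1 - q_n) S_n` and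
`lam_n = 4 q_n lam_{n+1} (1 - q_{n+1})` eliminates every quantity but the `q`'s. -/
theorem recursion (h : IsEquilibrium Δ σ S₀ lam S α β) (hΔ : 0 < Δ) (hσ : 0 < σ)
    (hS₀ : 0 < S₀) (n : Fin M) :
    8 * (α n.castSucc.succ * lam n.castSucc) ^ 2 * (1 - α n.castSucc.succ * lam n.castSucc) *
      (1 - 2 * (α n.succ.succ * lam n.succ)) = 1 - 2 * (α n.castSucc.succ * lam n.castSucc) := by
  have hs := h.S_pos hΔ hσ hS₀ n.castSucc.castSucc
  have h1 := h.lam_sq_eq hΔ hσ hS₀ n.castSucc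
  have h1' := h.lam_sq_eq hΔ hσ hS₀ n.succ
  have h2 := h.lam_pos n.castSucc
  have h2' := h.lam_pos n.succ
  have h3 : 0 < 1 - α n.castSucc.succ * lam n.castSucc := by
    linarith [h.second_order n.castSucc]
  have h3' : 0 < 1 - α n.succ.succ * lam n.succ := by linarith [h.second_order n.succ]
  have h4 := h.α_eq n.succ
  have h5 := h.S_eq n.castSucc
  rw [h.denom_eq hΔ hσ hS₀] at h5
  rw [eq_div_iff (by positivity)] at h4 h5
  rw [← Fin.succ_castSucc] at h4 h1'
  generalize hq : α n.castSucc.succ * lam n.castSucc = q at *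
  generalize hρ : α n.succ.succ * lam n.succ = ρ at *
  have h6 : q * (4 * lam n.succ * (1 - ρ)) = lam n.castSucc := by
    rw [← hq]; linear_combination lam n.castSucc * h4
  have h7 : S n.castSucc.succ * (2 * (1 - q)) = S n.castSucc.castSucc := by
    have hσ' : σ ^ 2 ≠ 0 := by positivity
    apply mul_right_cancel₀ hσ'
    linear_combination h5
  apply mul_left_cancel₀ hs.ne'
  rw [← h1]
  linear_combination (-8 * q ^ 2 * (1 - q) * (1 - 2 * ρ)) * h7 - 16 * q ^ 2 * (1 - q) ^ 2 * h1' +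
    4 * (1 - q) ^ 2 * σ ^ 2 * Δ * (q * (4 * lam n.succ * (1 - ρ)) + lam n.castSucc) * h6

/-- Since `q_{n+1} ≥ 0`, the recursion gives `8 q² (1 - q) ≥ 1 - 2 q`, which fails below `0.275`. -/
theorem q_lower_bound (h : IsEquilibrium Δ σ S₀ lam S α β) (hΔ : 0 < Δ) (hσ : 0 < σ)
    (hS₀ : 0 < S₀) (n : Fin M) : 0.275 ≤ α n.castSucc.succ * lam n.castSucc := by
  have h1 := h.recursion hΔ hσ hS₀ n
  have h2 := h.two_mul_lt_one hΔ hσ hS₀ n.castSucc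
  have h2' := h.two_mul_lt_one hΔ hσ hS₀ n.succ
  have h3 : 0 < α n.castSucc.succ * lam n.castSucc := by
    rw [Fin.succ_castSucc]; exact mul_pos (h.α_pos _) (h.lam_pos _)
  have h4 : 0 ≤ α n.succ.succ * lam n.succ := by
    refine mul_nonneg ?_ (h.lam_pos _).le
    generalize n.succ.succ = m
    refine Fin.lastCases ?_ (fun i => (h.α_pos i).le) m
    rw [h.α_last]
  generalize α n.castSucc.succ * lam n.castSucc = q at *
  generalize α n.succ.succ * lam n.succ = ρ at *
  by_contra! hcon
  have h5 : 8 * q ^ 2 * (1 - q) * (1 - 2 * ρ) ≤ 8 * q ^ 2 * (1 - q) * 1 := by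
    have : 0 ≤ 8 * q ^ 2 * (1 - q) := mul_nonneg (by positivity) (by linarith)
    exact mul_le_mul_of_nonneg_left (by linarith) this
  have h6 : q ^ 2 ≤ 0.275 * q := by nlinarith
  nlinarith [mul_le_mul_of_nonneg_right h6 (by linarith : 0 ≤ 1 - q)]

end

/-- Two or more periods before the end, `q_{n+1} ≥ 0.275` is available, which gains the factor `1 -
2 * 0.275 = 0.45` in the recursion and improves the bound. -/
theorem q_lower_bound' {M : ℕ} {Δ σ S₀ : ℝ} {lam : Fin (M + 2) → ℝ} {S α : Fin (M + 3) → ℝ}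
    {β : Fin (M + 2) → ℝ} (h : IsEquilibrium Δ σ S₀ lam S α β) (hΔ : 0 < Δ) (hσ : 0 < σ)
    (hS₀ : 0 < S₀) (n : Fin M) :
    0.35 ≤ α n.castSucc.castSucc.succ * lam n.castSucc.castSucc := by
  have h1 := h.recursion hΔ hσ hS₀ n.castSucc
  have h2 := h.two_mul_lt_one hΔ hσ hS₀ n.castSucc.castSucc
  have h2' := h.two_mul_lt_one hΔ hσ hS₀ n.castSucc.succ
  have h3 : 0 < α n.castSucc.castSucc.succ * lam n.castSucc.castSucc := by
    rw [Fin.succ_castSucc]; exact mul_pos (h.α_pos _) (h.lam_pos _)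
  have h4 : 0.275 ≤ α n.castSucc.succ.succ * lam n.castSucc.succ := by
    have := h.q_lower_bound hΔ hσ hS₀ n.succ
    rwa [← Fin.succ_castSucc] at this
  generalize α n.castSucc.castSucc.succ * lam n.castSucc.castSucc = q at *
  generalize α n.castSucc.succ.succ * lam n.castSucc.succ = ρ at *
  by_contra! hcon
  have h5 : 8 * q ^ 2 * (1 - q) * (1 - 2 * ρ) ≤ 8 * q ^ 2 * (1 - q) * 0.45 := by
    have : 0 ≤ 8 * q ^ 2 * (1 - q) := mul_nonneg (by positivity) (by linarith)
    exact mul_le_mul_of_nonneg_left (by linarith) this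
  have h6 : q ^ 2 ≤ 0.35 * q := by nlinarith
  nlinarith [mul_le_mul_of_nonneg_right h6 (by linarith : 0 ≤ 1 - q)]

theorem _root_.Kyle.diagonal_bound {q : ℝ} (h1 : 0.275 ≤ q) (h2 : 2 * q < 1) :
    0.699 ≤ q * (1 - 2 * q + 2 * q ^ 2) / ((1 - 2 * q) * (1 - q) ^ 2) := by
  have h3 : 0 < 1 - 2 * q := by linarith
  have h4 : 0 < 1 - q := by linarith
  rw [le_div_iff₀ (by positivity)]
  nlinarith [mul_nonneg (sub_nonneg.2 h1) (sq_nonneg q), mul_nonneg (sub_nonneg.2 h1) h3.le,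
    mul_nonneg (sub_nonneg.2 h1) (sq_nonneg (1 - q))]

theorem _root_.Kyle.diagonal_bound' {q : ℝ} (h1 : 0.35 ≤ q) (h2 : 2 * q < 1) :
    1.5 ≤ q * (1 - 2 * q + 2 * q ^ 2) / ((1 - 2 * q) * (1 - q) ^ 2) := by
  have h3 : 0 < 1 - 2 * q := by linarith
  have h4 : 0 < 1 - q := by linarith
  rw [le_div_iff₀ (by positivity)]
  nlinarith [mul_nonneg (sub_nonneg.2 h1) (sq_nonneg q), mul_nonneg (sub_nonneg.2 h1) h3.le,
    mul_nonneg (sub_nonneg.2 h1) (sq_nonneg (1 - q))]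

theorem one_lt_abs_prod {M : ℕ} (hM : 1 ≤ M) {Δ σ S₀ : ℝ} {lam : Fin (M + 2) → ℝ}
    {S α : Fin (M + 3) → ℝ} {β : Fin (M + 2) → ℝ} (h : IsEquilibrium Δ σ S₀ lam S α β)
    (hΔ : 0 < Δ) (hσ : 0 < σ) (hS₀ : 0 < S₀) :
    1 < |∏ n : Fin (M + 1), coeffA Δ σ (β n.castSucc) (S n.castSucc.castSucc) *
      coeffF Δ (lam n.castSucc) (α n.castSucc.succ)| := by
  simp_rw [h.coeffA_mul_coeffF hΔ hσ hS₀, Finset.abs_prod, abs_neg]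
  rw [Fin.prod_univ_castSucc]
  have h1 := diagonal_bound (h.q_lower_bound hΔ hσ hS₀ (Fin.last M))
    (h.two_mul_lt_one hΔ hσ hS₀ _)
  have h2 := fun n : Fin M => diagonal_bound' (h.q_lower_bound' hΔ hσ hS₀ n)
    (h.two_mul_lt_one hΔ hσ hS₀ _)
  have h3 := Finset.prod_le_prod (s := (Finset.univ : Finset (Fin M))) (f := fun _ => (1.5 : ℝ))
    (fun _ _ => by norm_num) (fun n _ => (h2 n).trans (le_abs_self _))
  rw [Finset.prod_const, Finset.card_univ, Fintype.card_fin] at h3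
  have h4 : (1.5 : ℝ) ≤ 1.5 ^ M := le_self_pow₀ (by norm_num) (by omega)
  calc (1 : ℝ) < 1.5 * 0.699 := by norm_num
    _ ≤ _ := mul_le_mul (h4.trans h3) (h1.trans (le_abs_self _)) (by norm_num) (by positivity)

end IsEquilibrium

/-! ### Splitting off the last trading time -/

section Restriction

variable {M : ℕ}

/-- The inclusion of `ℝ^M` in `ℝ^(M+1)` with last coordinate `0`. -/
noncomputable def snocL (M : ℕ) : (Fin M → ℝ) →L[ℝ] (Fin (M + 1) → ℝ) :=
  LinearMap.toContinuousLinearMap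
    { toFun := fun y => Fin.snoc (α := fun _ => ℝ) y 0
      map_add' := fun y y' => by
        ext n; refine Fin.lastCases ?_ (fun i => ?_) n <;> simp
      map_smul' := fun c y => by
        ext n; refine Fin.lastCases ?_ (fun i => ?_) n <;> simp }

@[simp] theorem snocL_castSucc (y : Fin M → ℝ) (n : Fin M) : snocL M y n.castSucc = y n := by
  simp [snocL]

@[simp] theorem snocL_last (y : Fin M → ℝ) : snocL M y (Fin.last M) = 0 := by
  simp [snocL]

theorem fwdScan_castSucc (D E h : Fin (M + 1) → ℝ) (n : Fin (M + 1)) :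
    fwdScan D E h n.castSucc =
      fwdScan (fun i => D i.castSucc) (fun i => E i.castSucc) (fun i => h i.castSucc) n := by
  refine congrFun (fwdScan_unique _ _ _ (s := fun n => fwdScan D E h n.castSucc) (by simp)
    fun n => ?_) n
  rw [← Fin.succ_castSucc, fwdScan_succ]

theorem lowerMap_castSucc (A C D E h : Fin (M + 1) → ℝ) (n : Fin M) :
    lowerMap A C D E h n.castSucc = lowerMap (fun i => A i.castSucc) (fun i => C i.castSucc)
      (fun i => D i.castSucc) (fun i => E i.castSucc) (fun i => h i.castSucc) n := by
  rw [lowerMap_apply, fwdScan_castSucc, lowerMap_apply]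

theorem bwdScan_castSucc_eq (H I y : Fin (M + 1) → ℝ) (n : Fin (M + 1)) :
    bwdScan H I y 0 n.castSucc =
      bwdScan (fun i => H i.castSucc) (fun i => I i.castSucc) (fun i => y i.castSucc)
        (H (Fin.last M) * y (Fin.last M)) n := by
  refine congrFun (bwdScan_unique _ _ _ _ (a := fun n => bwdScan H I y 0 n.castSucc)
    (by simp [bwdScan_castSucc]) fun n => ?_) n
  rw [bwdScan_castSucc, ← Fin.succ_castSucc]

/-- If the last diagonal coefficient vanishes, the forward recursion ignores the last input. -/
theorem lowerMap_snocL_initL {A : Fin (M + 1) → ℝ} (hA : A (Fin.last M) = 0)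
    (C D E h : Fin (M + 1) → ℝ) :
    lowerMap A C D E (snocL M (initL M h)) = lowerMap A C D E h := by
  ext n
  refine Fin.lastCases ?_ (fun i => ?_) n
  · simp [lowerMap_apply, hA, fwdScan_castSucc]
  · simp [lowerMap_castSucc]

end Restriction

/-! ### Volume expansion of `T` at the equilibrium -/

namespace IsEquilibrium

/-- At the equilibrium, the derivative of `T` ignores the last coordinate and expands the volume in
the other coordinates. -/
theorem exists_hasStrictFDerivAt {M : ℕ} (hM : 1 ≤ M) {Δ σ S₀ : ℝ} {lam : Fin (M + 2) → ℝ}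
    {S α : Fin (M + 3) → ℝ} {β : Fin (M + 2) → ℝ} (h : IsEquilibrium Δ σ S₀ lam S α β)
    (hΔ : 0 < Δ) (hσ : 0 < σ) (hS₀ : 0 < S₀) :
    ∃ K : (Fin (M + 1) → ℝ) →L[ℝ] (Fin (M + 2) → ℝ),
      HasStrictFDerivAt (T Δ σ S₀) (K.comp (initL (M + 1))) β ∧
        1 < |((initL (M + 1)).comp K).det| := by
  have hX := fun n => denom_pos hΔ hσ (h.S_pos hΔ hσ hS₀ (Fin.castSucc n)) (β n)
  have hq := fun n => h.two_mul_lt_one hΔ hσ hS₀ n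
  have hq' : ∀ n, 0 < 1 - α n.succ * lam n := fun n => by linarith [h.second_order n]
  have hS := h.S_pos hΔ hσ hS₀
  have hβ := h.β_pos hΔ hσ hS₀
  have hlam := h.lam_pos
  have hT := hasStrictFDerivAt_T hΔ hσ hS₀ h.mem_domT
  have hDL := fun x => funext (fderiv_kyleLambda hΔ hσ hS₀ β x)
  have hDB := fun x => funext (fderiv_bestResponse hΔ h.mem_domT x)
  rw [h.kyleLambda_eq] at hDB hT
  rw [h.condVar_eq] at hDL
  rw [h.valueCoeff_eq] at hDB
  -- `α_N = 0` gives `β_N² S_{N-1} Δ = σ²`, the critical point of the last pricing coefficient as a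
  -- function of the last intensity.
  have hAlast : coeffA Δ σ (β (Fin.last _)) (S (Fin.last (M + 1)).castSucc) = 0 := by
    rw [coeffA, h.sq_mul_eq hΔ hσ hS₀, Fin.succ_last, h.α_last]
    simp
  have hHneg : ∀ n, coeffH (lam n) (α n.succ) < 0 := fun n => by
    unfold coeffH
    have := hq n; have := hq' n; have := hlam n
    exact div_neg_of_neg_of_pos (by linarith) (by positivity)
  have hCpos : ∀ n, 0 < coeffC Δ σ (β n) (S n.castSucc) := fun n => by
    unfold coeffC
    have := hX n; have := hβ n
    positivity
  refine ⟨((fderiv ℝ (bestResponse Δ) lam).comp (fderiv ℝ (kyleLambda Δ σ S₀) β)).comp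
    (snocL (M + 1)), ?_, ?_⟩
  · convert! hT using 1
    ext1 x
    simp only [ContinuousLinearMap.comp_apply]
    congr 1
    rw [hDL, hDL]
    exact lowerMap_snocL_initL hAlast _ _ _ x
  · rw [ContinuousLinearMap.det]
    refine one_lt_abs_det_of_scan
      (A := fun n => coeffA Δ σ (β n.castSucc) (S n.castSucc.castSucc))
      (C := fun n => coeffC Δ σ (β n.castSucc) (S n.castSucc.castSucc))
      (D := fun n => coeffD Δ σ (β n.castSucc) (S n.castSucc.castSucc))
      (E := fun n => coeffE Δ σ (β n.castSucc) (S n.castSucc.castSucc))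
      (F := fun n => coeffF Δ (lam n.castSucc) (α n.castSucc.succ))
      (G := fun n => coeffG Δ (lam n.castSucc) (α n.castSucc.succ))
      (H := fun n => coeffH (lam n.castSucc) (α n.castSucc.succ))
      (I := fun n => coeffI (lam n.castSucc) (α n.castSucc.succ))
      -- As `A_N = 0`, the last pricing coefficient varies only by `C_N s`, with `s` the variation
      -- of `S_{N-1}`. The backward scan over the earlier periods therefore starts from `H_N C_N s =
      -- -θ s`.
      (θ := -(coeffH (lam (Fin.last _)) (α (Fin.last _).succ) *
        coeffC Δ σ (β (Fin.last _)) (S (Fin.last _).castSucc)))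
      (fun n => ?_) (fun n => hCpos _) (fun n => ?_) (fun n => ?_) (fun n => ?_) (fun n => ?_)
      (fun n => hHneg _) (fun n => ?_) ?_ (h.one_lt_abs_prod hM hΔ hσ hS₀) _ (fun x n => ?_)
    · have h1 := hX n.castSucc
      have h2 := hS n.castSucc.castSucc
      have h3 : 0 < α n.castSucc.succ * lam n.castSucc := by
        have := h.q_lower_bound hΔ hσ hS₀ n
        linarith
      rw [coeffA, h.sq_mul_eq hΔ hσ hS₀]
      rw [h.sq_mul_eq hΔ hσ hS₀] at h1
      have h4 : 0 < σ ^ 2 - (1 - 2 * (α n.castSucc.succ * lam n.castSucc)) * σ ^ 2 := by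
        have : 0 < 2 * (α n.castSucc.succ * lam n.castSucc) * σ ^ 2 := by positivity
        linarith
      positivity
    · have h1 := hX n.castSucc
      have h2 := hS n.castSucc.castSucc
      have h3 := hβ n.castSucc
      unfold coeffD
      exact div_neg_of_neg_of_pos (neg_neg_of_pos (by positivity)) (by positivity)
    · have h1 := hX n.castSucc
      unfold coeffE
      positivity
    · exact coeffF_neg hΔ (hlam _).ne' (hq' _).ne'
    · have h1 := hq' n.castSucc
      unfold coeffG
      exact div_neg_of_neg_of_pos (by norm_num) (by positivity)
    · have h1 := hq' n.castSucc
      unfold coeffI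
      positivity
    · exact neg_pos.2 (mul_neg_of_neg_of_pos (hHneg _) (hCpos _))
    · change fderiv ℝ (bestResponse Δ) lam (fderiv ℝ (kyleLambda Δ σ S₀) β (snocL (M + 1) x))
        n.castSucc = _
      rw [hDB, hDL, upperMap_apply, Fin.succ_castSucc, bwdScan_castSucc_eq]
      simp only [lowerMap_castSucc, snocL_castSucc]
      congr 3
      rw [lowerMap_apply, snocL_last, fwdScan_castSucc]
      simp only [snocL_castSucc]
      ring

end IsEquilibrium

/-! ### Second moments of Gaussian combinations -/

section Moments

open scoped NNReal

/-- The second moment of a linear combination of independent centred Gaussian variables. -/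
theorem lintegral_sq_sum_gaussian {Ω : Type*} [MeasurableSpace Ω] {P : Measure Ω}
    [IsProbabilityMeasure P] {ι : Type*} [Fintype ι] {w : ι → Ω → ℝ} {V : ι → ℝ≥0}
    (hw : ∀ i, HasLaw (w i) (gaussianReal 0 (V i)) P) (hind : iIndepFun w P) (c : ι → ℝ) :
    ∫⁻ ω, ENNReal.ofReal ((∑ i, c i * w i ω) ^ 2) ∂P = ENNReal.ofReal (∑ i, c i ^ 2 * V i) := by
  have hmem : ∀ i, MemLp (w i) 2 P := fun i => by
    have h1 : MemLp id 2 (P.map (w i)) := by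
      rw [(hw i).map_eq]; exact memLp_id_gaussianReal 2
    exact h1.comp_of_map (hw i).aemeasurable
  have hmem' : ∀ i, MemLp (fun ω => c i * w i ω) 2 P := fun i => (hmem i).const_mul (c i)
  have hX : MemLp (∑ i, fun ω => c i * w i ω) 2 P := memLp_finsetSum' _ fun i _ => hmem' i
  have hmean : ∀ i, ∫ ω, w i ω ∂P = 0 := fun i => by
    rw [(hw i).integral_eq]; simp
  have hXmean : P[∑ i, fun ω => c i * w i ω] = 0 := by
    simp only [Finset.sum_apply]
    rw [integral_finsetSum _ fun i _ => (hmem' i).integrable (by norm_num)]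
    simp [integral_const_mul, hmean]
  have hvar : Var[∑ i, fun ω => c i * w i ω; P] = ∑ i, c i ^ 2 * V i := by
    rw [IndepFun.variance_sum (fun i _ => hmem' i)]
    · refine Finset.sum_congr rfl fun i _ => ?_
      rw [variance_const_mul, (hw i).variance_eq, variance_id_gaussianReal]
    · intro i _ j _ hij
      exact (hind.indepFun hij).comp (measurable_const_mul (c i)) (measurable_const_mul (c j))
  rw [variance_eq_sub hX, hXmean] at hvar
  rw [← hvar, ← ofReal_integral_eq_lintegral_ofReal]
  · simp
  · simpa using hX.integrable_sq
  · exact Filter.Eventually.of_forall fun ω => sq_nonneg _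

end Moments

/-! ### Policies as linear combinations of `v, u_1, …, u_N` -/

section Policies

variable {Ω : Type*} {N : ℕ} {Δ σ S₀ : ℝ} (v : Ω → ℝ) (u : Fin N → Ω → ℝ) (lam β : Fin N → ℝ)

theorem price_succ (n : Fin N) (ω : Ω) :
    price Δ v u lam β n.succ ω = price Δ v u lam β n.castSucc ω +
      lam n * (u n ω + β n * (v ω - price Δ v u lam β n.castSucc ω) * Δ) := rfl

theorem order_holdings (n : Fin N) (ω : Ω) :
    order (holdings Δ v u lam β) n ω = β n * (v ω - price Δ v u lam β n.castSucc ω) * Δ := by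
  change holdings Δ v u lam β n.castSucc ω +
    β n * (v ω - price Δ v u lam β n.castSucc ω) * Δ - holdings Δ v u lam β n.castSucc ω = _
  ring

/-- The coefficients of the stock orders as linear combinations of `v, u_1, …, u_N`: the orders
when `v` and `u_n` are the coordinate functionals. -/
noncomputable def orderCoeff (Δ : ℝ) (lam β : Fin N → ℝ) (n : Fin N) : Fin (N + 1) → ℝ :=
  order (holdings Δ (Pi.single 0 1) (fun k => Pi.single k.succ 1) lam β) n

/-- The price recursion is linear in `(v, u)`, so running it on the sample space `Fin (N + 1)` with
unit vectors as inputs computes the coefficients. -/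
theorem price_eq_sum (n : Fin (N + 1)) (ω : Ω) :
    price Δ v u lam β n ω = ∑ i, price Δ (Pi.single 0 1) (fun k => Pi.single k.succ 1) lam β n i *
      (Fin.cons v u : Fin (N + 1) → Ω → ℝ) i ω := by
  induction n using Fin.induction with
  | zero => simp [price]
  | succ n ih =>
    have hv : v ω = ∑ i : Fin (N + 1), (Pi.single 0 1 : Fin (N + 1) → ℝ) i *
        (Fin.cons v u : Fin (N + 1) → Ω → ℝ) i ω := by
      simp [Pi.single_apply]
    have hu : u n ω = ∑ i : Fin (N + 1), (Pi.single n.succ 1 : Fin (N + 1) → ℝ) i *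
        (Fin.cons v u : Fin (N + 1) → Ω → ℝ) i ω := by
      simp [Pi.single_apply]
    simp only [price_succ]
    rw [ih, hv, hu, ← Finset.sum_sub_distrib, Finset.mul_sum, Finset.sum_mul,
      ← Finset.sum_add_distrib, Finset.mul_sum, ← Finset.sum_add_distrib]
    exact Finset.sum_congr rfl fun i _ => by ring

theorem order_eq_sum (n : Fin N) (ω : Ω) :
    order (holdings Δ v u lam β) n ω =
      ∑ i, orderCoeff Δ lam β n i * (Fin.cons v u : Fin (N + 1) → Ω → ℝ) i ω := by
  have hv : v ω = ∑ i : Fin (N + 1), (Pi.single 0 1 : Fin (N + 1) → ℝ) i *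
      (Fin.cons v u : Fin (N + 1) → Ω → ℝ) i ω := by
    simp [Pi.single_apply]
  simp only [orderCoeff, order_holdings]
  rw [price_eq_sum, hv, ← Finset.sum_sub_distrib, Finset.mul_sum, Finset.sum_mul]
  exact Finset.sum_congr rfl fun i _ => by ring

/-- Each step multiplies the coefficient of `v` in `v - p_n` by `1 - lam_n β_n Δ`, which is exactly
the factor by which the conditional variance shrinks. -/
theorem one_sub_price_coeff (hΔ : 0 < Δ) (hσ : 0 < σ) (hS₀ : 0 < S₀) (n : Fin (N + 1)) :
    (1 - price Δ (Pi.single 0 1) (fun k => Pi.single k.succ 1) (kyleLambda Δ σ S₀ β) β n 0) * S₀ =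
      condVar Δ σ S₀ β n := by
  induction n using Fin.induction with
  | zero => simp [price]
  | succ n ih =>
    have hX := denom_pos hΔ hσ (condVar_pos β hΔ hσ hS₀ n.castSucc) (β n)
    rw [price_succ, condVar_succ, ← ih, kyleLambda, ← ih]
    rw [← ih] at hX
    have h1 : (Pi.single n.succ 1 : Fin (N + 1) → ℝ) 0 = 0 := by
      simp [(Fin.succ_ne_zero n).symm]
    simp only [h1, Pi.single_eq_same]
    generalize price Δ (Pi.single 0 1) (fun k => Pi.single k.succ 1) (kyleLambda Δ σ S₀ β) β
      n.castSucc 0 = p at *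
    generalize hp : β n ^ 2 * ((1 - p) * S₀) * Δ + σ ^ 2 = X at *
    field_simp
    linear_combination -(1 - p) * hp

theorem orderCoeff_zero (hΔ : 0 < Δ) (hσ : 0 < σ) (hS₀ : 0 < S₀) (n : Fin N) :
    orderCoeff Δ (kyleLambda Δ σ S₀ β) β n 0 = β n * condVar Δ σ S₀ β n.castSucc * (Δ / S₀) := by
  rw [orderCoeff, order_holdings, ← one_sub_price_coeff β hΔ hσ hS₀, Pi.single_eq_same]
  field_simp

theorem continuous_orderCoeff (hΔ : 0 < Δ) (hσ : 0 < σ) (hS₀ : 0 < S₀) (n : Fin N)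
    (i : Fin (N + 1)) :
    Continuous fun β : Fin N → ℝ => orderCoeff Δ (kyleLambda Δ σ S₀ β) β n i := by
  have hlam : Continuous (kyleLambda Δ σ S₀ : (Fin N → ℝ) → Fin N → ℝ) :=
    (contDiff_kyleLambda hΔ hσ hS₀).continuous
  have hp : ∀ m : Fin (N + 1), Continuous fun β : Fin N → ℝ => price Δ
      (Pi.single 0 1 : Fin (N + 1) → ℝ) (fun k => Pi.single k.succ 1) (kyleLambda Δ σ S₀ β) β m i := by
    intro m
    induction m using Fin.induction with
    | zero => simp only [price, Fin.induction_zero]; fun_prop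
    | succ m ih => simp only [price_succ]; fun_prop
  have := hp n.castSucc
  simp only [orderCoeff, order_holdings]
  fun_prop

open scoped NNReal in
theorem policyNorm_sub [MeasurableSpace Ω] {P : Measure Ω} [IsProbabilityMeasure P]
    {v : Ω → ℝ} {u : Fin N → Ω → ℝ} {V : Fin (N + 1) → ℝ≥0}
    (hw : ∀ i, HasLaw ((Fin.cons v u : Fin (N + 1) → Ω → ℝ) i) (gaussianReal 0 (V i)) P)
    (hind : iIndepFun (Fin.cons v u : Fin (N + 1) → Ω → ℝ) P) (lam β lam' β' : Fin N → ℝ) :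
    policyNorm P (holdings Δ v u lam β - holdings Δ v u lam' β') =
      (∑ n, ENNReal.ofReal (∑ i, (orderCoeff Δ lam β n i - orderCoeff Δ lam' β' n i) ^ 2 * V i)) ^
        (1 / 2 : ℝ) := by
  rw [policyNorm]
  congr 1
  refine Finset.sum_congr rfl fun n _ => ?_
  rw [← lintegral_sq_sum_gaussian hw hind]
  refine lintegral_congr fun ω => ?_
  have h1 : order (holdings Δ v u lam β - holdings Δ v u lam' β') n ω =
      order (holdings Δ v u lam β) n ω - order (holdings Δ v u lam' β') n ω := by
    simp only [order, Pi.sub_apply]; ring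
  rw [h1, order_eq_sum, order_eq_sum, ← Finset.sum_sub_distrib]
  simp only [sub_mul]

end Policies

/-! ### Norm convergence versus convergence of intensities -/

section Convergence

open scoped NNReal

variable {Ω : Type*} [MeasurableSpace Ω] {P : Measure Ω} [IsProbabilityMeasure P] {N : ℕ}
  {Δ σ S₀ : ℝ} {v : Ω → ℝ} {u : Fin N → Ω → ℝ} {V : Fin (N + 1) → ℝ≥0}

theorem tendsto_policyNorm_sub (hΔ : 0 < Δ) (hσ : 0 < σ) (hS₀ : 0 < S₀)
    (hw : ∀ i, HasLaw ((Fin.cons v u : Fin (N + 1) → Ω → ℝ) i) (gaussianReal 0 (V i)) P)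
    (hind : iIndepFun (Fin.cons v u : Fin (N + 1) → Ω → ℝ) P) (β₀ : Fin N → ℝ) :
    Tendsto (fun β => policyNorm P (policy Δ v u σ S₀ β - policy Δ v u σ S₀ β₀)) (𝓝 β₀) (𝓝 0) := by
  simp only [policy, policyNorm_sub hw hind]
  have hc : Continuous fun β : Fin N → ℝ => (∑ n, ENNReal.ofReal
      (∑ i, (orderCoeff Δ (kyleLambda Δ σ S₀ β) β n i -
        orderCoeff Δ (kyleLambda Δ σ S₀ β₀) β₀ n i) ^ 2 * V i)) ^ (1 / 2 : ℝ) := by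
    have := fun n i => continuous_orderCoeff (N := N) hΔ hσ hS₀ n i
    refine ENNReal.continuous_rpow_const.comp (continuous_finsetSum _ fun n _ =>
      ENNReal.continuous_ofReal.comp (continuous_finsetSum _ fun i _ => ?_))
    fun_prop
  have := hc.tendsto β₀
  simpa using this

/-- Convergence of policies implies convergence of the trading intensities. -/
theorem tendsto_of_tendsto_policyNorm_sub (hΔ : 0 < Δ) (hσ : 0 < σ) (hS₀ : 0 < S₀)
    (hw : ∀ i, HasLaw ((Fin.cons v u : Fin (N + 1) → Ω → ℝ) i) (gaussianReal 0 (V i)) P)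
    (hV : 0 < V 0) (hind : iIndepFun (Fin.cons v u : Fin (N + 1) → Ω → ℝ) P)
    {β₀ : Fin N → ℝ} {b : ℕ → Fin N → ℝ}
    (hb : Tendsto (fun m => policyNorm P (policy Δ v u σ S₀ (b m) - policy Δ v u σ S₀ β₀)) atTop
      (𝓝 0)) : Tendsto b atTop (𝓝 β₀) := by
  simp only [policy, policyNorm_sub hw hind] at hb
  -- The coefficients of `v` alone suffice: they equal `β_n S_{n-1} Δ / S₀`, from which the
  -- intensities are recovered forward in time, starting from the fixed variance `S₀`.
  have h1 : ∀ n, Tendsto (fun m => orderCoeff Δ (kyleLambda Δ σ S₀ (b m)) (b m) n 0) atTop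
      (𝓝 (orderCoeff Δ (kyleLambda Δ σ S₀ β₀) β₀ n 0)) := by
    intro n
    have h2 := (ENNReal.continuous_rpow_const (y := 2)).tendsto 0 |>.comp hb
    simp only [Function.comp_def, ← ENNReal.rpow_mul] at h2
    norm_num at h2
    have h3 : Tendsto (fun m => ENNReal.ofReal ((orderCoeff Δ (kyleLambda Δ σ S₀ (b m)) (b m) n 0 -
        orderCoeff Δ (kyleLambda Δ σ S₀ β₀) β₀ n 0) ^ 2 * V 0)) atTop (𝓝 0) := by
      refine tendsto_of_tendsto_of_tendsto_of_le_of_le tendsto_const_nhds h2 (fun _ => zero_le)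
        fun m => ?_
      refine le_trans ?_ (Finset.single_le_sum (fun _ _ => zero_le) (Finset.mem_univ n))
      refine ENNReal.ofReal_le_ofReal ?_
      exact Finset.single_le_sum (f := fun i => (orderCoeff Δ (kyleLambda Δ σ S₀ (b m)) (b m) n i -
        orderCoeff Δ (kyleLambda Δ σ S₀ β₀) β₀ n i) ^ 2 * (V i : ℝ))
        (fun i _ => by positivity) (Finset.mem_univ 0)
    have h4 := (ENNReal.tendsto_toReal ENNReal.zero_ne_top).comp h3
    have hV' : (0 : ℝ) < V 0 := hV
    simp only [Function.comp_def, ENNReal.toReal_zero] at h4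
    have h5 := (h4.div_const (V 0 : ℝ)).sqrt
    rw [tendsto_iff_norm_sub_tendsto_zero]
    refine (h5.congr fun m => ?_).trans (by simp)
    rw [ENNReal.toReal_ofReal (by positivity), mul_div_cancel_right₀ _ hV'.ne', Real.sqrt_sq_eq_abs,
      Real.norm_eq_abs]
  simp only [orderCoeff_zero _ hΔ hσ hS₀] at h1
  have h2 : ∀ n : Fin N, Tendsto (fun m => b m n * condVar Δ σ S₀ (b m) n.castSucc) atTop
      (𝓝 (β₀ n * condVar Δ σ S₀ β₀ n.castSucc)) := by
    intro n
    have h3 := (h1 n).div_const (Δ / S₀)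
    have : Δ / S₀ ≠ 0 := by positivity
    simpa [mul_div_cancel_right₀ _ this] using h3
  have h3 : ∀ n : Fin N, Tendsto (fun m => condVar Δ σ S₀ (b m) n.castSucc) atTop
      (𝓝 (condVar Δ σ S₀ β₀ n.castSucc)) → Tendsto (fun m => b m n) atTop (𝓝 (β₀ n)) := by
    intro n hn
    have h4 := (h2 n).div hn (condVar_pos β₀ hΔ hσ hS₀ _).ne'
    rw [mul_div_cancel_right₀ _ (condVar_pos β₀ hΔ hσ hS₀ _).ne'] at h4
    refine h4.congr fun m => ?_
    exact mul_div_cancel_right₀ _ (condVar_pos (b m) hΔ hσ hS₀ _).ne'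
  have h4 : ∀ n : Fin (N + 1), Tendsto (fun m => condVar Δ σ S₀ (b m) n) atTop
      (𝓝 (condVar Δ σ S₀ β₀ n)) := by
    intro n
    induction n using Fin.induction with
    | zero => simp
    | succ n ih =>
      simp only [condVar_succ]
      exact (ih.mul_const _).div ((((h3 n ih).pow 2).mul ih).mul_const Δ |>.add_const _)
        (denom_pos hΔ hσ (condVar_pos β₀ hΔ hσ hS₀ _) _).ne'
  exact tendsto_pi_nhds.2 fun n => h3 n (h4 _)

end Convergence

theorem ConsistentExtension.iterate_step {Ω : Type*} [MeasurableSpace Ω]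
    {P : Measure Ω} {N : ℕ} {Δ σ S₀ : ℝ} {v : Ω → ℝ} {u : Fin N → Ω → ℝ}
    (E : ConsistentExtension P v u Δ σ S₀)
    {β : Fin N → ℝ} (hβ : ∀ k, (T Δ σ S₀)^[k] β ∈ domT Δ σ S₀ N) (m : ℕ) :
    E.step^[m] (some (policy Δ v u σ S₀ β)) = some (policy Δ v u σ S₀ ((T Δ σ S₀)^[m] β)) := by
  induction m with
  | zero => rfl
  | succ m ih =>
    rw [Function.iterate_succ_apply', ih, Function.iterate_succ_apply', ConsistentExtension.step,
      if_pos (E.policy_mem _ (hβ m)), E.consistent _ (hβ m)]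

end Kyle

theorem mainTheorem3 {Ω : Type*} [MeasurableSpace Ω] (P : Measure Ω) [IsProbabilityMeasure P]
    (N : ℕ) (hN : 3 ≤ N) (Δ σ S₀ : ℝ) (hΔ : 0 < Δ) (hσ : 0 < σ) (hS₀ : 0 < S₀)
    (v : Ω → ℝ) (u : Fin N → Ω → ℝ)
    (hv : HasLaw v (gaussianReal 0 S₀.toNNReal) P)
    (hu : ∀ n, HasLaw (u n) (gaussianReal 0 (σ ^ 2 * Δ).toNNReal) P)
    (hindep : iIndepFun (Fin.cons v u : Fin (N + 1) → Ω → ℝ) P)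
    (lamHat : Fin N → ℝ) (SHat αHat : Fin (N + 1) → ℝ) (βHat : Fin N → ℝ)
    (hEq : Kyle.IsEquilibrium Δ σ S₀ lamHat SHat αHat βHat)
    (E : Kyle.ConsistentExtension P v u Δ σ S₀) :
    ¬ E.LocallyStable (Kyle.holdings Δ v u lamHat βHat) := by
  rintro ⟨ε, hε, hstable⟩
  obtain ⟨M, rfl⟩ : ∃ M, N = M + 2 := ⟨N - 2, by omega⟩
  have hw : ∀ i, HasLaw ((Fin.cons v u : Fin (M + 3) → Ω → ℝ) i) (gaussianReal 0
      ((Fin.cons S₀.toNNReal fun _ => (σ ^ 2 * Δ).toNNReal : Fin (M + 3) → NNReal) i)) P := by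
    intro i
    refine Fin.cases ?_ (fun n => ?_) i
    · exact hv
    · exact hu n
  have hxhat : Kyle.holdings Δ v u lamHat βHat = Kyle.policy Δ v u σ S₀ βHat := by
    rw [Kyle.policy, hEq.kyleLambda_eq]
  rw [hxhat] at hstable
  obtain ⟨K, hK, hdet⟩ := hEq.exists_hasStrictFDerivAt (by omega) hΔ hσ hS₀
  have hV := (Kyle.tendsto_policyNorm_sub hΔ hσ hS₀ hw hindep βHat).eventually_lt_const
    (ENNReal.ofReal_pos.2 hε)
  obtain ⟨β, hβV, hβne, hβG, hβlim⟩ := Kyle.exists_orbit_not_tendsto Kyle.measurable_T K hK hdet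
    (Kyle.ae_mem_domT hΔ hσ hS₀ hEq.mem_domT)
    (fun x hx => ⟨_, Kyle.hasStrictFDerivAt_T hΔ hσ hS₀ hx.1,
      Kyle.det_fderiv_T_ne_zero hΔ hσ hS₀ hx.1 hx.2⟩) hV
  have hback := fun {b : ℕ → Fin (M + 2) → ℝ} => Kyle.tendsto_of_tendsto_policyNorm_sub
    (β₀ := βHat) (b := b) hΔ hσ hS₀ hw (by simpa using hS₀) hindep
  refine hβlim (hback ?_)
  have hpos : 0 < Kyle.policyNorm P
      (Kyle.policy Δ v u σ S₀ β - Kyle.policy Δ v u σ S₀ βHat) := by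
    rw [pos_iff_ne_zero]
    intro h0
    -- Injectivity of `β ↦ policy β` up to norm zero is the convergence statement applied to a
    -- constant sequence.
    refine hβne (tendsto_nhds_unique tendsto_const_nhds (hback (b := fun _ => β) ?_))
    rw [h0]
    exact tendsto_const_nhds
  have hlim := hstable _ (E.policy_mem β (hβG 0).1) hpos hβV
  simp only [E.iterate_step fun k => (hβG k).1] at hlim
  exact hlim
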